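/- Call a function $p:\mathbb{C}\to[0,\infty)$ a weight if (w1) there is $K>0$ with $p(z)\ge K\ln(1+|z|^2)$ for all $z\in\mathbb{C}$, and (w2) there are $D_0,E_0>0$ such that $p(z)\le D_0\,p(w)+E_0$ whenever $|z-w|\le 1$. Let $$A_p=\{f\text{ entire}: \text{there are } A,B>0 \text{ with } |f(z)|\le A e^{Bp(z)}\text{ for all }z\in\mathbb{C}\}.$$ For $\Gamma\subset\mathbb{C}$ let $\mathcal R_\Gamma(A_p)=\{f|_\Gamma : f\in A_p\}$, and let $A_p(\Gamma)$ be the space of functions $\omega:\Gamma\to\mathbb{C}$ for which there are $A,B>0$ with $|\omega(\gamma)|\le Ae^{Bp(\gamma)}$ for all $\gamma\in\Gamma$. We say that $\Gamma$ is $A_p$-interpolating if $\mathcal R_\Gamma(A_p)=A_p(\Gamma)$. For $\omega:\Lambda\to\mathbb{C}$ and pairwise distinct points of $\Lambda$, define divided differences by $\Delta^0\omega(\lambda_1)=\omega(\lambda_1)$ and, for $j\ge1$, $$\Delta^j\omega(\lambda_1,\dots,\lambda_{j+1})=\frac{\Delta^{j-1}\omega(\lambda_2,\dots,\lambda_{j+1})-\Delta^{j-1}\omega(\lambda_1,\dots,\lambda_j)}{\lambda_{j+1}-\lambda_1}.$$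 For $n\ge1$ let $X^{n-1}_p(\Lambda)$ be the set of functions $\omega:\Lambda\to\mathbb{C}$ such that, for some $B>0$, the quantity $$|\Delta^{n-1}\omega(\lambda_1,\dots,\lambda_n)|\,e^{-B[p(\lambda_1)+\cdots+p(\lambda_n)]}$$ is bounded over all $n$-tuples of pairwise distinct points of $\Lambda$. **Theorem.** Let $p$ be a weight, let $\Lambda\subset\mathbb{C}$ be a discrete set without accumulation points in $\mathbb{C}$ (that is, closed and discrete), and let $n\ge1$. Then $\mathcal R_\Lambda(A_p)=X^{n-1}_p(\Lambda)$ if and only if $\Lambda$ is the union of $n$ (possibly empty, not necessarily disjoint) $A_p$-interpolating sets. -/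

import Mathlib

namespace HormanderTrace

/-- A weight on the complex plane: a nonnegative function satisfying the growth condition (w1)
and the slow-variation condition (w2). -/
structure IsWeight (p : ℂ → ℝ) : Prop where
  nonneg : ∀ z, 0 ≤ p z
  w1 : ∃ K : ℝ, 0 < K ∧ ∀ z : ℂ, K * Real.log (1 + ‖z‖ ^ 2) ≤ p z
  w2 : ∃ D₀ E₀ : ℝ, 0 < D₀ ∧ 0 < E₀ ∧ ∀ z w : ℂ, ‖z - w‖ ≤ 1 → p z ≤ D₀ * p w + E₀

/-- The Hörmander algebra `A_p`: entire functions `f` with `|f| ≤ A exp (B p)` for some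
`A, B > 0`. -/
def hormanderAlgebra (p : ℂ → ℝ) : Set (ℂ → ℂ) :=
  {f | Differentiable ℂ f ∧
    ∃ A B : ℝ, 0 < A ∧ 0 < B ∧ ∀ z, ‖f z‖ ≤ A * Real.exp (B * p z)}

/-- The space `A_p(Λ)` of functions on `Λ` with `|ω| ≤ A exp (B p)` for some `A, B > 0`. -/
def sequenceSpace (p : ℂ → ℝ) (Λ : Set ℂ) : Set (Λ → ℂ) :=
  {ω | ∃ A B : ℝ, 0 < A ∧ 0 < B ∧ ∀ l : Λ, ‖ω l‖ ≤ A * Real.exp (B * p l)}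

/-- The trace `R_Λ(A_p)`: the image of `A_p` under restriction to `Λ`. -/
def traceSpace (p : ℂ → ℝ) (Λ : Set ℂ) : Set (Λ → ℂ) :=
  (fun (f : ℂ → ℂ) (l : Λ) => f l) '' hormanderAlgebra p

/-- `Λ` is interpolating for `A_p` when `R_Λ(A_p) = A_p(Λ)`. -/
def IsInterpolating (p : ℂ → ℝ) (Λ : Set ℂ) : Prop :=
  traceSpace p Λ = sequenceSpace p Λ

/-- The divided difference `Δ^j ω (x₀, …, x_j)`, meaningful for pairwise distinct points. -/
noncomputable def dividedDifference {Λ : Set ℂ} (ω : Λ → ℂ) :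
    (j : ℕ) → (Fin (j + 1) → Λ) → ℂ
  | 0, x => ω (x 0)
  | j + 1, x =>
      (dividedDifference ω j (fun i => x i.succ) -
        dividedDifference ω j (fun i => x i.castSucc)) /
      ((x (Fin.last (j + 1)) : ℂ) - (x 0 : ℂ))

/-- The space `X^m_p(Λ)`: functions on `Λ` such that, for some `B > 0`, the quantity
`|Δ^m ω (x₀, …, x_m)| exp (-B (p x₀ + ⋯ + p x_m))` is bounded over all `(m + 1)`-tuples of
pairwise distinct points of `Λ`. -/
def dividedDifferenceSpace (p : ℂ → ℝ) (Λ : Set ℂ) (m : ℕ) : Set (Λ → ℂ) :=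
  {ω | ∃ B C : ℝ, 0 < B ∧ ∀ x : Fin (m + 1) → Λ, Function.Injective x →
    ‖dividedDifference ω m x‖ * Real.exp (-(B * ∑ i, p (x i))) ≤ C}

end HormanderTrace

/-! Divided differences of a function in `A_p` are obtained by iterating difference quotients. The
maximum principle bounds each quotient at the cost of a factor exp(B p(a)) in the node a, so traces
always lie in X^{n-1}.

Both directions need one uniformity principle. If prescribed values can be interpolated on every
subset of Γ, with zero on the rest, then a Baire argument on the space of subsets, with Montel's
theorem for closedness, gives one-point pieces with common constants
(`exists_uniform_of_forall_subset`). On an interpolating set this yields functions equal to 1 at γ,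
0 at the other points and as small as exp(-M p(γ)). They force separation, hence summability of
exp(-M p(γ)), and they turn interpolation into a convergent series
(`IsInterpolating.exists_series`).

If Λ is a union of n interpolating sets, the interpolant is built as in Newton's formula, one set at
a time (`exists_extension`). When f already agrees with F on the union U of the earlier sets, the
error at a new point γ is a divided difference of F - f over γ and at most n - 1 nodes of U, times
the product of the distances to these nodes. A function vanishing on U and equal to that product at
γ corrects the error.

Conversely, let w(l) be the product of l - t over at most n - 1 nodes t near l, chosen with minimal
modulus. Every restriction of w to a subset, extended by zero, lies in X^{n-1}, so there are
uniformly bounded functions equal to w(l) at l and to 0 on the rest of Λ. By a Schwarz lemma, a disc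
of radius ε exp(-C p(l)) about l then holds at most n points of Λ
(`exists_card_le_of_traceSpace_eq`). Hence Λ splits into small, mutually separated clusters of at
most n points. Each class Γ_i takes at most one point per cluster; data on Γ_i extend to Λ as
constants on clusters, which lie in X^{n-1} and so are traces. -/

namespace HormanderTrace

variable {p : ℂ → ℝ}

/-! ### Divided differences in symmetric form -/

/-- The divided difference of `F` over a finite set of nodes, in Lagrange form. -/
noncomputable def nodeDifference (F : ℂ → ℂ) (s : Finset ℂ) : ℂ :=
  ∑ a ∈ s, F a / ∏ b ∈ s.erase a, (a - b)

lemma nodeDifference_insert (F : ℂ → ℂ) {s : Finset ℂ} {a : ℂ} (ha : a ∉ s) :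
    nodeDifference F (insert a s) =
      F a / ∏ b ∈ s, (a - b) + ∑ c ∈ s, F c / ((c - a) * ∏ b ∈ s.erase c, (c - b)) := by
  unfold nodeDifference
  rw [Finset.sum_insert ha, Finset.erase_insert ha]
  congr 1
  refine Finset.sum_congr rfl fun c hc => ?_
  have hne : c ≠ a := fun h => ha (h ▸ hc)
  rw [Finset.erase_insert_of_ne hne.symm, Finset.prod_insert]
  exact fun h => ha (Finset.mem_of_mem_erase h)

lemma prod_sub_ne_zero {s : Finset ℂ} {a : ℂ} (ha : a ∉ s) : ∏ b ∈ s, (a - b) ≠ 0 :=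
  Finset.prod_ne_zero_iff.2 fun b hb h => ha (by rwa [sub_eq_zero.1 h])

/-- The Lagrange form is symmetric in its nodes, so the recursion may split at any two of them.
Exchanging nodes and splitting at two nodes with different values both rely on this freedom. -/
lemma nodeDifference_insert_insert (F : ℂ → ℂ) {t : Finset ℂ} {a b : ℂ} (hab : a ≠ b)
    (ha : a ∉ t) (hb : b ∉ t) :
    nodeDifference F (insert a (insert b t)) =
      (nodeDifference F (insert b t) - nodeDifference F (insert a t)) / (b - a) := by
  have hba : b - a ≠ 0 := sub_ne_zero.2 hab.symm
  have hab' : a - b ≠ 0 := sub_ne_zero.2 hab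
  rw [nodeDifference_insert F (a := a) (s := insert b t) (by simp [hab, ha]),
    nodeDifference_insert F ha, nodeDifference_insert F hb, Finset.prod_insert hb,
    Finset.sum_insert hb, Finset.erase_insert hb]
  have key : ∀ c ∈ t, F c / ((c - a) * ∏ d ∈ (insert b t).erase c, (c - d)) =
      (F c / ((c - b) * ∏ d ∈ t.erase c, (c - d)) -
        F c / ((c - a) * ∏ d ∈ t.erase c, (c - d))) / (b - a) := by
    intro c hc
    have h1 : c ≠ a := fun h => ha (h ▸ hc)
    have h2 : c ≠ b := fun h => hb (h ▸ hc)
    rw [Finset.erase_insert_of_ne h2.symm,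
      Finset.prod_insert fun h => hb (Finset.mem_of_mem_erase h)]
    have h3 : ∏ d ∈ t.erase c, (c - d) ≠ 0 := prod_sub_ne_zero (Finset.notMem_erase c t)
    have h1' := sub_ne_zero.2 h1
    have h2' := sub_ne_zero.2 h2
    field_simp
    ring
  rw [Finset.sum_congr rfl key, ← Finset.sum_div, Finset.sum_sub_distrib]
  have hpa := prod_sub_ne_zero ha
  have hpb := prod_sub_ne_zero hb
  field_simp
  ring

lemma image_univ_zero {k : ℕ} (f : Fin (k + 1) → ℂ) :
    Finset.univ.image f = insert (f 0) (Finset.univ.image fun i : Fin k => f i.succ) := by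
  ext z
  simp [Fin.exists_fin_succ, eq_comm]

lemma image_univ_last {k : ℕ} (f : Fin (k + 1) → ℂ) :
    Finset.univ.image f =
      insert (f (Fin.last k)) (Finset.univ.image fun i : Fin k => f i.castSucc) := by
  ext z
  simp only [Finset.mem_image, Finset.mem_univ, true_and, Finset.mem_insert]
  constructor
  · rintro ⟨i, rfl⟩
    induction i using Fin.lastCases with
    | last => exact Or.inl rfl
    | cast i => exact Or.inr ⟨i, rfl⟩
  · rintro (rfl | ⟨i, rfl⟩)
    exacts [⟨_, rfl⟩, ⟨_, rfl⟩]

lemma dividedDifference_eq_nodeDifference {Λ : Set ℂ} {ω : Λ → ℂ} {F : ℂ → ℂ}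
    (hF : ∀ l : Λ, F l = ω l) (m : ℕ) (x : Fin (m + 1) → Λ) (hx : Function.Injective x) :
    dividedDifference ω m x =
      nodeDifference F (Finset.univ.image fun i => (x i : ℂ)) := by
  induction m with
  | zero => simp [dividedDifference, nodeDifference, hF]
  | succ m ih =>
    have hx' : Function.Injective fun i => (x i : ℂ) := Subtype.val_injective.comp hx
    set t : Finset ℂ := Finset.univ.image fun i : Fin m => (x i.succ.castSucc : ℂ) with ht
    have e1 : (Finset.univ.image fun i : Fin (m + 1) => (x i.succ : ℂ)) =
        insert (x (Fin.last (m + 1)) : ℂ) t := by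
      rw [image_univ_last]
      rfl
    have e2 : (Finset.univ.image fun i : Fin (m + 1) => (x i.castSucc : ℂ)) =
        insert (x 0 : ℂ) t := by
      rw [image_univ_zero]
      rfl
    have e3 : (Finset.univ.image fun i : Fin (m + 2) => (x i : ℂ)) =
        insert (x 0 : ℂ) (insert (x (Fin.last (m + 1)) : ℂ) t) := by
      rw [← e1, image_univ_zero]
    have h0 : (x 0 : ℂ) ∉ t := by
      simp only [ht, Finset.mem_image, Finset.mem_univ, true_and, not_exists]
      intro i hi
      have := hx' hi
      exact absurd (congrArg Fin.val this) (by simp)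
    have hl : (x (Fin.last (m + 1)) : ℂ) ∉ t := by
      simp only [ht, Finset.mem_image, Finset.mem_univ, true_and, not_exists]
      intro i hi
      have := congrArg Fin.val (hx' hi)
      simp at this
      omega
    have h0l : (x 0 : ℂ) ≠ x (Fin.last (m + 1)) := fun h =>
      absurd (congrArg Fin.val (hx' h)) (by simp)
    rw [e3, nodeDifference_insert_insert F h0l h0 hl, dividedDifference,
      ih (fun i => x i.succ) (hx.comp (Fin.succ_injective _)),
      ih (fun i => x i.castSucc) (hx.comp (Fin.castSucc_injective _)), e1, e2]

lemma nodeDifference_const (c : ℂ) {s : Finset ℂ} (hs : 2 ≤ s.card) :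
    nodeDifference (fun _ => c) s = 0 := by
  obtain ⟨k, hk⟩ : ∃ k, s.card = k + 2 := ⟨s.card - 2, by omega⟩
  clear hs
  induction k generalizing s with
  | zero =>
    obtain ⟨a, b, hab, rfl⟩ := Finset.card_eq_two.1 hk
    have h := nodeDifference_insert_insert (fun _ => c) (t := ∅) hab (by simp) (by simp)
    simpa [nodeDifference] using h
  | succ k ih =>
    obtain ⟨a, s', ha, rfl, hs'⟩ := Finset.card_eq_succ.1 hk
    obtain ⟨b, t, hb, rfl, ht⟩ := Finset.card_eq_succ.1 hs'
    have ha' : a ≠ b ∧ a ∉ t := by simpa using ha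
    rw [nodeDifference_insert_insert _ ha'.1 ha'.2 hb, ih hs', ih, sub_zero, zero_div]
    rw [Finset.card_insert_of_notMem ha'.2, ht]

lemma nodeDifference_congr {F G : ℂ → ℂ} {s : Finset ℂ} (h : ∀ a ∈ s, F a = G a) :
    nodeDifference F s = nodeDifference G s :=
  Finset.sum_congr rfl fun a ha => by rw [h a ha]

lemma nodeDifference_sub (F G : ℂ → ℂ) (s : Finset ℂ) :
    nodeDifference (fun z => F z - G z) s = nodeDifference F s - nodeDifference G s := by
  simp only [nodeDifference, sub_div, Finset.sum_sub_distrib]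

lemma nodeDifference_insert_of_eq_zero {F : ℂ → ℂ} {s : Finset ℂ} {a : ℂ} (ha : a ∉ s)
    (h : ∀ b ∈ s, F b = 0) : nodeDifference F (insert a s) = F a / ∏ b ∈ s, (a - b) := by
  rw [nodeDifference_insert F ha, Finset.sum_eq_zero fun c hc => by rw [h c hc, zero_div],
    add_zero]

/-- Subtracting the constant `F a`, whose differences over two or more nodes vanish, kills the term
of `a`. In every other term the factor `b - a` cancels. -/
lemma nodeDifference_insert_of_slope {F g : ℂ → ℂ} {s : Finset ℂ} {a : ℂ} (ha : a ∉ s)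
    (hs : s.Nonempty) (h : ∀ b ∈ s, (b - a) * g b = F b - F a) :
    nodeDifference F (insert a s) = nodeDifference g s := by
  have hc : nodeDifference (fun _ => F a) (insert a s) = 0 := by
    apply nodeDifference_const
    rw [Finset.card_insert_of_notMem ha]
    have := hs.card_pos
    omega
  rw [← sub_zero (nodeDifference F _), ← hc, ← nodeDifference_sub, nodeDifference_insert _ ha,
    sub_self, zero_div, zero_add]
  refine Finset.sum_congr rfl fun b hb => ?_
  have hne : b - a ≠ 0 := sub_ne_zero.2 fun h => ha (h ▸ hb)
  rw [← h b hb, mul_div_mul_left _ _ hne]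

/-- The bound on divided differences of order `m` over nodes in `Λ` that defines `X^m_p(Λ)`,
for a function defined on the whole plane. -/
def HasBoundedDifferences (p : ℂ → ℝ) (Λ : Set ℂ) (m : ℕ) (F : ℂ → ℂ) : Prop :=
  ∃ A B : ℝ, 0 < A ∧ 0 < B ∧ ∀ s : Finset ℂ, ↑s ⊆ Λ → s.card = m + 1 →
    ‖nodeDifference F s‖ ≤ A * Real.exp (B * ∑ a ∈ s, p a)

lemma mem_dividedDifferenceSpace_iff {p : ℂ → ℝ} {Λ : Set ℂ} {m : ℕ} {ω : Λ → ℂ} {F : ℂ → ℂ}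
    (hF : ∀ l : Λ, F l = ω l) :
    ω ∈ dividedDifferenceSpace p Λ m ↔ HasBoundedDifferences p Λ m F := by
  constructor
  · rintro ⟨B, C, hB, h⟩
    refine ⟨max C 1, B, by positivity, hB, fun s hs hcard => ?_⟩
    let e := s.equivFinOfCardEq hcard
    let x : Fin (m + 1) → Λ := fun i => ⟨e.symm i, hs (e.symm i).2⟩
    have hx : Function.Injective x := fun i j hij =>
      e.symm.injective (Subtype.ext (congrArg (fun l : Λ => (l : ℂ)) hij))
    have hx' : Function.Injective fun i => (x i : ℂ) := Subtype.val_injective.comp hx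
    have him : (Finset.univ.image fun i => (x i : ℂ)) = s := by
      ext z
      simp only [Finset.mem_image, Finset.mem_univ, true_and]
      constructor
      · rintro ⟨i, rfl⟩
        exact (e.symm i).2
      · intro hz
        exact ⟨e ⟨z, hz⟩, by simp [x]⟩
    have h1 := h x hx
    rw [dividedDifference_eq_nodeDifference hF m x hx, him] at h1
    have hsum : ∑ i, p (x i) = ∑ a ∈ s, p a := by
      rw [← him, Finset.sum_image fun i _ j _ hij => hx' hij]
    rw [hsum, Real.exp_neg, ← div_eq_mul_inv, div_le_iff₀ (Real.exp_pos _)] at h1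
    refine h1.trans ?_
    gcongr
    exact le_max_left _ _
  · rintro ⟨A, B, -, hB, h⟩
    refine ⟨B, A, hB, fun x hx => ?_⟩
    have hx' : Function.Injective fun i => (x i : ℂ) := Subtype.val_injective.comp hx
    rw [dividedDifference_eq_nodeDifference hF m x hx, Real.exp_neg, ← div_eq_mul_inv,
      div_le_iff₀ (Real.exp_pos _), ← Finset.sum_image (f := p) fun i _ j _ hij => hx' hij]
    refine h _ ?_ ?_
    · intro z
      simp only [Finset.coe_image, Finset.coe_univ, Set.image_univ, Set.mem_range]
      rintro ⟨i, rfl⟩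
      exact (x i).2
    · rw [Finset.card_image_of_injective _ hx', Finset.card_univ, Fintype.card_fin]

/-! ### Slow variation and growth of weights -/

lemma IsWeight.slowly_varying (hp : IsWeight p) (k : ℕ) :
    ∃ D E : ℝ, 0 < D ∧ 0 < E ∧ ∀ z w : ℂ, ‖z - w‖ ≤ k → p z ≤ D * p w + E := by
  obtain ⟨D₀, E₀, hD₀, hE₀, h₀⟩ := hp.w2
  induction k with
  | zero =>
    refine ⟨1, 1, one_pos, one_pos, fun z w h => ?_⟩
    have : z = w := by simpa [sub_eq_zero] using h
    rw [this]
    linarith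
  | succ k ih =>
    obtain ⟨D, E, hD, hE, h⟩ := ih
    refine ⟨D₀ * D, D₀ * E + E₀, by positivity, by positivity, fun z w hzw => ?_⟩
    have hk : (0 : ℝ) < k + 1 := by positivity
    push_cast at hzw
    -- `u` is the point a fraction 1/(k+1) of the way from `z` to `w`: (w2) compares `z` with `u`,
    -- and the induction hypothesis `u` with `w`.
    set u : ℂ := z + ((1 / (k + 1) : ℝ) : ℂ) * (w - z) with hu
    have h1 : ‖z - u‖ ≤ 1 := by
      have : z - u = ((1 / (k + 1) : ℝ) : ℂ) * (z - w) := by rw [hu]; ring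
      rw [this, norm_mul, Complex.norm_real, Real.norm_of_nonneg (by positivity), div_mul_eq_mul_div,
        div_le_one hk]
      linarith
    have h2 : ‖u - w‖ ≤ k := by
      have hk1 : (1 : ℝ) - 1 / (k + 1) = k / (k + 1) := by field_simp; ring
      have : u - w = ((1 - 1 / (k + 1) : ℝ) : ℂ) * (z - w) := by rw [hu]; push_cast; ring
      rw [this, norm_mul, Complex.norm_real, hk1, Real.norm_of_nonneg (by positivity),
        div_mul_eq_mul_div, div_le_iff₀ hk]
      gcongr
    calc p z ≤ D₀ * p u + E₀ := h₀ _ _ h1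
      _ ≤ D₀ * (D * p w + E) + E₀ := by gcongr; exact h _ _ h2
      _ = _ := by ring

lemma IsWeight.growth (hp : IsWeight p) :
    ∃ κ : ℝ, 0 < κ ∧ ∀ z : ℂ, 1 + ‖z‖ ^ 2 ≤ Real.exp (κ * p z) := by
  obtain ⟨K, hK, h⟩ := hp.w1
  refine ⟨1 / K, by positivity, fun z => ?_⟩
  rw [← Real.log_le_iff_le_exp (by positivity), div_mul_eq_mul_div, one_mul, le_div_iff₀ hK,
    mul_comm]
  exact h z

/-! ### Difference quotients of entire functions -/

/-- `f` is entire with the Hörmander bound of constants `A` and `B`. -/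
def EntireBound (p : ℂ → ℝ) (A B : ℝ) (f : ℂ → ℂ) : Prop :=
  Differentiable ℂ f ∧ ∀ z, ‖f z‖ ≤ A * Real.exp (B * p z)

lemma norm_le_of_sphere {g : ℂ → ℂ} (hg : Differentiable ℂ g) {c : ℂ} {R M : ℝ} (hR : 0 < R)
    (h : ∀ z, ‖z - c‖ = R → ‖g z‖ ≤ M) {z : ℂ} (hz : ‖z - c‖ ≤ R) : ‖g z‖ ≤ M := by
  refine Complex.norm_le_of_forall_mem_frontier_norm_le (U := Metric.ball c R)
    Metric.isBounded_ball hg.diffContOnCl (fun w hw => ?_) ?_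
  · rw [frontier_ball c hR.ne', mem_sphere_iff_norm] at hw
    exact h w hw
  · rwa [closure_ball c hR.ne', mem_closedBall_iff_norm]

lemma differentiable_dslope {f : ℂ → ℂ} (hf : Differentiable ℂ f) (a : ℂ) :
    Differentiable ℂ (dslope f a) := by
  rw [← differentiableOn_univ] at hf ⊢
  exact (Complex.differentiableOn_dslope Filter.univ_mem).2 hf

/-- On the circle of radius R ≥ 1 the division by `w - a` does not enlarge `f w - f a`; the maximum
principle carries the bound inside. -/
lemma norm_dslope_le {f : ℂ → ℂ} (hf : Differentiable ℂ f) {a : ℂ} {R M : ℝ} (hR : 1 ≤ R)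
    (h : ∀ z, ‖z - a‖ ≤ R → ‖f z‖ ≤ M) {z : ℂ} (hz : ‖z - a‖ ≤ R) :
    ‖dslope f a z‖ ≤ 2 * M := by
  refine norm_le_of_sphere (differentiable_dslope hf a) (by linarith) (fun w hw => ?_) hz
  have h1 := sub_smul_dslope f a w
  have h2 : ‖w - a‖ * ‖dslope f a w‖ = ‖f w - f a‖ := by rw [← h1, norm_smul]
  have h3 : ‖f w - f a‖ ≤ M + M :=
    (norm_sub_le _ _).trans (add_le_add (h _ hw.le) (h _ (by simp; linarith)))
  nlinarith [norm_nonneg (dslope f a w)]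

/-- A Schwarz lemma with finitely many zeros. -/
lemma norm_le_mul_prod_of_zeros {M : ℝ} (c : ℂ) (T : Finset ℂ) :
    ∀ f : ℂ → ℂ, Differentiable ℂ f → (∀ z, ‖z - c‖ ≤ 2 → ‖f z‖ ≤ M) →
      (∀ t ∈ T, f t = 0) → (∀ t ∈ T, ‖t - c‖ ≤ 1) → ‖f c‖ ≤ M * ∏ t ∈ T, ‖c - t‖ := by
  induction T using Finset.induction_on with
  | empty =>
    intro f _ h _ _
    simpa using h c (by simp)
  | insert t T ht ih =>
    intro f hf h h0 h1
    have hg : ∀ w, (w - t) * dslope f t w = f w := fun w => by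
      have := sub_smul_dslope f t w
      rwa [h0 t (Finset.mem_insert_self _ _), sub_zero, smul_eq_mul] at this
    have := ih (dslope f t) (differentiable_dslope hf t) ?_ ?_ ?_
    · rw [Finset.prod_insert ht, ← hg c, norm_mul]
      calc ‖c - t‖ * ‖dslope f t c‖ ≤ ‖c - t‖ * (M * ∏ t ∈ T, ‖c - t‖) := by gcongr
        _ = _ := by ring
    · intro z hz
      refine norm_le_of_sphere (differentiable_dslope hf t) two_pos (fun w hw => ?_) hz
      have h2 : ‖w - t‖ * ‖dslope f t w‖ = ‖f w‖ := by rw [← norm_mul, hg]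
      -- On the circle of radius 2 about `c` every zero `t` is at distance at least 1, so dividing
      -- it out keeps the bound `M`.
      have h3 : 1 ≤ ‖w - t‖ := by
        have := norm_sub_norm_le (w - c) (t - c)
        rw [hw, sub_sub_sub_cancel_right] at this
        linarith [h1 t (Finset.mem_insert_self _ _)]
      have h4 := h w hw.le
      nlinarith [norm_nonneg (dslope f t w)]
    · intro s hs
      have h2 := hg s
      rw [h0 s (Finset.mem_insert_of_mem hs)] at h2
      exact (mul_eq_zero.1 h2).resolve_left (sub_ne_zero.2 fun h => ht (h ▸ hs))
    · exact fun s hs => h1 s (Finset.mem_insert_of_mem hs)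

/-- Within distance 1 of `a` the maximum principle and slow variation apply; farther away the
division is harmless. The constants depend neither on `f` nor on `a`, and the bound is linear in
`A`, so the estimate can be iterated over the nodes. -/
lemma EntireBound.dslope (hp : IsWeight p) {B : ℝ} (hB : 0 < B) :
    ∃ A' B' : ℝ, 0 < A' ∧ 0 < B' ∧ ∀ A f a, EntireBound p A B f →
      EntireBound p (A * (A' * Real.exp (B' * p a))) B' (dslope f a) := by
  obtain ⟨D, E, hD, hE, h⟩ := hp.slowly_varying 1
  refine ⟨2 * Real.exp (B * E), B * (D + 1), by positivity, by positivity, fun A f a hf =>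
    ⟨differentiable_dslope hf.1 a, fun z => ?_⟩⟩
  have hA : 0 ≤ A := nonneg_of_mul_nonneg_left ((norm_nonneg _).trans (hf.2 0)) (Real.exp_pos _)
  have hpa := hp.nonneg a
  have hpz := hp.nonneg z
  have e : A * (2 * Real.exp (B * E) * Real.exp (B * (D + 1) * p a)) *
      Real.exp (B * (D + 1) * p z) =
      2 * (A * Real.exp (B * E + B * (D + 1) * p a + B * (D + 1) * p z)) := by
    rw [Real.exp_add, Real.exp_add]; ring
  rw [e]
  rcases le_total ‖z - a‖ 1 with hz | hz
  · refine norm_dslope_le hf.1 le_rfl (fun w hw => ?_) hz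
    refine (hf.2 w).trans ?_
    gcongr
    have := h w a (by simpa using hw)
    nlinarith [mul_nonneg hB.le hpa, mul_nonneg (mul_nonneg hB.le hD.le) hpz,
      mul_nonneg hB.le hpz, mul_le_mul_of_nonneg_left this hB.le]
  · have h1 := sub_smul_dslope f a z
    have h2 : ‖z - a‖ * ‖_root_.dslope f a z‖ = ‖f z - f a‖ := by rw [← h1, norm_smul]
    have h3 : ∀ w, 0 ≤ p w → p w ≤ p a + p z → ‖f w‖ ≤
        A * Real.exp (B * E + B * (D + 1) * p a + B * (D + 1) * p z) := by
      intro w hw hw'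
      refine (hf.2 w).trans ?_
      gcongr
      nlinarith [mul_nonneg hB.le hE.le, mul_nonneg (mul_nonneg hB.le hD.le) hpz,
        mul_nonneg (mul_nonneg hB.le hD.le) hpa, mul_le_mul_of_nonneg_left hw' hB.le]
    have h4 := norm_sub_le (f z) (f a)
    nlinarith [norm_nonneg (_root_.dslope f a z), h3 z hpz (by linarith), h3 a hpa (by linarith)]

lemma norm_nodeDifference_le_of_entireBound (hp : IsWeight p) (m : ℕ) :
    ∀ B : ℝ, 0 < B → ∃ A' B' : ℝ, 0 < A' ∧ 0 < B' ∧ ∀ A f, EntireBound p A B f →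
      ∀ s : Finset ℂ, s.card = m + 1 →
        ‖nodeDifference f s‖ ≤ A * A' * Real.exp (B' * ∑ a ∈ s, p a) := by
  induction m with
  | zero =>
    refine fun B hB => ⟨1, B, one_pos, hB, fun A f hf s hs => ?_⟩
    obtain ⟨a, rfl⟩ := Finset.card_eq_one.1 hs
    simpa [nodeDifference] using hf.2 a
  | succ m ih =>
    intro B hB
    obtain ⟨A₁, B₁, hA₁, hB₁, h₁⟩ := EntireBound.dslope hp hB
    obtain ⟨A₂, B₂, hA₂, hB₂, h₂⟩ := ih B₁ hB₁
    refine ⟨A₁ * A₂, B₁ + B₂, by positivity, by positivity, fun A f hf s hs => ?_⟩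
    have hA : 0 ≤ A := nonneg_of_mul_nonneg_left ((norm_nonneg _).trans (hf.2 0)) (Real.exp_pos _)
    obtain ⟨a, t, ha, rfl, ht⟩ := Finset.card_eq_succ.1 hs
    rw [nodeDifference_insert_of_slope ha (g := dslope f a) (Finset.card_pos.1 (by omega))
      fun b _ => by simpa using sub_smul_dslope f a b, Finset.sum_insert ha]
    refine (h₂ _ _ (h₁ A f a hf) t ht).trans ?_
    have hS : 0 ≤ ∑ b ∈ t, p b := Finset.sum_nonneg fun b _ => hp.nonneg b
    have e : A * (A₁ * Real.exp (B₁ * p a)) * A₂ * Real.exp (B₂ * ∑ b ∈ t, p b) =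
        A * (A₁ * A₂) * Real.exp (B₁ * p a + B₂ * ∑ b ∈ t, p b) := by
      rw [Real.exp_add]; ring
    rw [e]
    gcongr
    nlinarith [mul_nonneg hB₁.le hS, mul_nonneg hB₂.le (hp.nonneg a)]

lemma hasBoundedDifferences_of_mem (hp : IsWeight p) (Λ : Set ℂ) (m : ℕ) {f : ℂ → ℂ}
    (hf : f ∈ hormanderAlgebra p) : HasBoundedDifferences p Λ m f := by
  obtain ⟨hd, A, B, hA, hB, h⟩ := hf
  obtain ⟨A', B', hA', hB', h'⟩ := norm_nodeDifference_le_of_entireBound hp m B hB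
  exact ⟨A * A', B', by positivity, hB', fun s _ hs => h' A f ⟨hd, h⟩ s hs⟩

/-! ### Lowering the order of bounded differences -/

lemma HasBoundedDifferences.sub {Λ : Set ℂ} {m : ℕ} {F G : ℂ → ℂ} (hp : IsWeight p)
    (hF : HasBoundedDifferences p Λ m F) (hG : HasBoundedDifferences p Λ m G) :
    HasBoundedDifferences p Λ m fun z => F z - G z := by
  obtain ⟨A, B, hA, hB, h⟩ := hF
  obtain ⟨A', B', hA', hB', h'⟩ := hG
  refine ⟨A + A', B + B', by positivity, by positivity, fun s hs hc => ?_⟩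
  have hS : 0 ≤ ∑ a ∈ s, p a := Finset.sum_nonneg fun b _ => hp.nonneg b
  rw [nodeDifference_sub, add_mul]
  refine (norm_sub_le _ _).trans (add_le_add ((h s hs hc).trans ?_) ((h' s hs hc).trans ?_)) <;>
  · gcongr
    linarith

/-- Compare `s` with a fixed set `T` of m + 1 points of Λ. Exchanging one point `a` of `s` for a
point `b` of `T` changes the difference by `b - a` times a difference of order m + 1, and `‖b - a‖`
is at most exponential in `p`. At most m + 1 exchanges lead from `s` to `T`. -/
lemma HasBoundedDifferences.of_succ {Λ : Set ℂ} {m : ℕ} {F : ℂ → ℂ} (hp : IsWeight p)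
    (hF : HasBoundedDifferences p Λ (m + 1) F) : HasBoundedDifferences p Λ m F := by
  by_cases hT : ∃ T : Finset ℂ, ↑T ⊆ Λ ∧ T.card = m + 1
  swap
  · exact ⟨1, 1, one_pos, one_pos, fun s hs hc => absurd ⟨s, hs, hc⟩ hT⟩
  obtain ⟨T, hTΛ, hTc⟩ := hT
  obtain ⟨A, B, hA, hB, h⟩ := hF
  obtain ⟨κ, hκ, hgr⟩ := hp.growth
  set P := ∑ a ∈ T, p a with hP
  -- `S` bounds the total weight of `s ∪ T`. An exchange only shrinks this union, so the same `S`
  -- serves throughout the induction on the number of points outside `T`.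
  have key : ∀ S : ℝ, 0 ≤ S → ∀ k : ℕ, ∀ s : Finset ℂ, ↑s ⊆ Λ → s.card = m + 1 →
      ∑ a ∈ s ∪ T, p a ≤ S → (s \ T).card = k →
      ‖nodeDifference F s‖ ≤
        ‖nodeDifference F T‖ + k * (2 * A * Real.exp ((B + κ) * S)) := by
    intro S hS0 k
    induction k with
    | zero =>
      intro s _ hc _ hk
      have : s = T := Finset.eq_of_subset_of_card_le
        (Finset.sdiff_eq_empty_iff_subset.1 (Finset.card_eq_zero.1 hk)) (by omega)
      simp [this]
    | succ k ih =>
      intro s hs hc hS hk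
      obtain ⟨a, ha⟩ : (s \ T).Nonempty := Finset.card_pos.1 (by omega)
      obtain ⟨b, hb⟩ : (T \ s).Nonempty := by
        rw [← Finset.card_pos, ← Finset.card_sdiff_eq_card_sdiff_iff.2 (hc.trans hTc.symm)]
        omega
      rw [Finset.mem_sdiff] at ha hb
      set t := s.erase a with ht
      have hst : s = insert a t := (Finset.insert_erase ha.1).symm
      have hat : a ∉ t := Finset.notMem_erase a s
      have hbt : b ∉ t := fun hbt => hb.2 (Finset.mem_of_mem_erase hbt)
      have hab : a ≠ b := fun hab => hb.2 (hab ▸ ha.1)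
      have htc : t.card = m := by rw [Finset.card_erase_of_mem ha.1, hc]; rfl
      have hsub : insert b t ∪ T ⊆ s ∪ T := by
        intro z hz
        simp only [ht, Finset.mem_union, Finset.mem_insert, Finset.mem_erase] at hz ⊢
        rcases hz with (rfl | hz) | hz
        exacts [Or.inr hb.1, Or.inl hz.2, Or.inr hz]
      have hmono : ∀ {u : Finset ℂ}, u ⊆ s ∪ T → ∑ z ∈ u, p z ≤ S := fun hu =>
        (Finset.sum_le_sum_of_subset_of_nonneg hu fun _ _ _ => hp.nonneg _).trans hS
      have h1 := ih (insert b t) ?_ ?_ (hmono hsub) ?_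
      · have h2 := nodeDifference_insert_insert F hab hat hbt
        rw [eq_div_iff (sub_ne_zero.2 hab.symm), ← hst] at h2
        have h3 : nodeDifference F s = nodeDifference F (insert b t) -
            nodeDifference F (insert a (insert b t)) * (b - a) := by rw [h2]; ring
        have hsub' : insert a (insert b t) ⊆ s ∪ T := by
          intro z hz
          simp only [ht, Finset.mem_union, Finset.mem_insert, Finset.mem_erase] at hz ⊢
          rcases hz with rfl | rfl | hz
          exacts [Or.inl ha.1, Or.inr hb.1, Or.inl hz.2]
        have h4 : ‖nodeDifference F (insert a (insert b t))‖ ≤ A * Real.exp (B * S) := by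
          refine (h _ ?_ ?_).trans ?_
          · intro z hz
            rcases Finset.mem_union.1 (hsub' hz) with hz | hz
            exacts [hs hz, hTΛ hz]
          · rw [Finset.card_insert_of_notMem (by simp [hab, hat]),
              Finset.card_insert_of_notMem hbt, htc]
          · gcongr
            exact hmono hsub'
        have h5 : ∀ c ∈ s ∪ T, ‖c‖ ≤ Real.exp (κ * S) := by
          intro c hc
          have h6 : p c ≤ S :=
            (Finset.single_le_sum (f := p) (fun _ _ => hp.nonneg _) hc).trans hS
          calc ‖c‖ ≤ 1 + ‖c‖ ^ 2 := by nlinarith [sq_nonneg (‖c‖ - 1), norm_nonneg c]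
            _ ≤ Real.exp (κ * p c) := hgr c
            _ ≤ _ := by gcongr
        have h6 : ‖b - a‖ ≤ 2 * Real.exp (κ * S) := by
          refine (norm_sub_le _ _).trans ?_
          linarith [h5 a (Finset.mem_union_left _ ha.1), h5 b (Finset.mem_union_right _ hb.1)]
        rw [h3]
        refine (norm_sub_le _ _).trans ?_
        rw [norm_mul]
        have h7 : ‖nodeDifference F (insert a (insert b t))‖ * ‖b - a‖ ≤
            (A * Real.exp (B * S)) * (2 * Real.exp (κ * S)) := by gcongr
        have h8 : (A * Real.exp (B * S)) * (2 * Real.exp (κ * S)) =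
            2 * A * Real.exp ((B + κ) * S) := by rw [add_mul, Real.exp_add]; ring
        push_cast
        linarith
      · intro z hz
        simp only [Finset.coe_insert, Set.mem_insert_iff, Finset.mem_coe] at hz
        rcases hz with rfl | hz
        exacts [hTΛ hb.1, hs (Finset.mem_of_mem_erase hz)]
      · rw [Finset.card_insert_of_notMem hbt, htc]
      · have : insert b t \ T = (s \ T).erase a := by
          ext z
          simp only [ht, Finset.mem_sdiff, Finset.mem_insert, Finset.mem_erase]
          constructor
          · rintro ⟨rfl | hz, hzT⟩
            exacts [absurd hb.1 hzT, ⟨hz.1, hz.2, hzT⟩]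
          · rintro ⟨h1, h2, h3⟩
            exact ⟨Or.inr ⟨h1, h2⟩, h3⟩
        rw [this, Finset.card_erase_of_mem (Finset.mem_sdiff.2 ha), hk]
        rfl
  refine ⟨‖nodeDifference F T‖ + (m + 1) * (2 * A * Real.exp ((B + κ) * P)), B + κ,
    by positivity, by positivity, fun s hs hc => ?_⟩
  have hP0 : 0 ≤ P := Finset.sum_nonneg fun b _ => hp.nonneg b
  have hS : 0 ≤ ∑ a ∈ s, p a := Finset.sum_nonneg fun b _ => hp.nonneg b
  have hunion : ∑ a ∈ s ∪ T, p a ≤ ∑ a ∈ s, p a + P := by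
    rw [← Finset.sum_union_inter]
    exact le_add_of_nonneg_right (Finset.sum_nonneg fun b _ => hp.nonneg b)
  refine (key _ (by positivity) _ s hs hc hunion rfl).trans ?_
  have hcard : ((s \ T).card : ℝ) ≤ m + 1 := by
    have := Finset.card_le_card (Finset.sdiff_subset (s := s) (t := T))
    rw [hc] at this
    exact_mod_cast this
  have h1 : 1 ≤ Real.exp ((B + κ) * ∑ a ∈ s, p a) := Real.one_le_exp (by positivity)
  rw [mul_add (B + κ), add_comm ((B + κ) * _), Real.exp_add, add_mul ‖nodeDifference F T‖]
  refine add_le_add (le_mul_of_one_le_right (norm_nonneg (nodeDifference F T)) h1) ?_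
  calc _ ≤ ((m : ℝ) + 1) * (2 * A * (Real.exp ((B + κ) * P) *
        Real.exp ((B + κ) * ∑ a ∈ s, p a))) := by gcongr
    _ = _ := by ring

lemma HasBoundedDifferences.mono {Λ : Set ℂ} {m k : ℕ} {F : ℂ → ℂ} (hp : IsWeight p)
    (hF : HasBoundedDifferences p Λ m F) (hk : k ≤ m) : HasBoundedDifferences p Λ k F := by
  induction m, hk using Nat.le_induction with
  | base => exact hF
  | succ m _ ih => exact ih (hF.of_succ hp)

/-! ### Montel's theorem and uniformity by Baire category -/

lemma EntireBound.mono (hp : IsWeight p) {A B A' B' : ℝ} {f : ℂ → ℂ} (hf : EntireBound p A B f)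
    (hA : A ≤ A') (hB : B ≤ B') : EntireBound p A' B' f := by
  refine ⟨hf.1, fun z => (hf.2 z).trans ?_⟩
  have hA0 : 0 ≤ A := nonneg_of_mul_nonneg_left ((norm_nonneg _).trans (hf.2 0)) (Real.exp_pos _)
  have := hp.nonneg z
  gcongr
  exact hA0.trans hA

/-- The difference of slopes is `z - w` times a second difference quotient, and each quotient
doubles the bound. The disc of radius 2 about `w` lies in the disc of radius 3 about `a`. -/
lemma norm_slope_sub_slope_le {f : ℂ → ℂ} (hf : Differentiable ℂ f) {a : ℂ} {M : ℝ}
    (h : ∀ z, ‖z - a‖ ≤ 3 → ‖f z‖ ≤ M) {z w : ℂ} (hz : z ≠ a) (hw : w ≠ a)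
    (hz1 : ‖z - a‖ ≤ 1) (hw1 : ‖w - a‖ ≤ 1) :
    ‖slope f a z - slope f a w‖ ≤ 4 * M * ‖z - w‖ := by
  rw [← dslope_of_ne f hz, ← dslope_of_ne f hw, ← sub_smul_dslope, norm_smul, mul_comm]
  gcongr
  refine (norm_dslope_le (differentiable_dslope hf a) (R := 2) (M := 2 * M) one_le_two
    (fun u hu => norm_dslope_le hf (by norm_num) h ?_) ?_).trans (by linarith)
  · linarith [norm_sub_le_norm_sub_add_norm_sub u w a]
  · have := norm_sub_le_norm_sub_add_norm_sub z a w
    rw [norm_sub_rev a w] at this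
    linarith

/-- A Lipschitz slope is uniformly continuous on the punctured disc, so it has a limit at `a`.
Unlike differentiability itself, the hypothesis passes to pointwise limits. -/
lemma differentiableAt_of_slope_lipschitz {f : ℂ → ℂ} {a : ℂ} {L : ℝ}
    (h : ∀ z w, z ≠ a → w ≠ a → ‖z - a‖ ≤ 1 → ‖w - a‖ ≤ 1 →
      ‖slope f a z - slope f a w‖ ≤ L * ‖z - w‖) : DifferentiableAt ℂ f a := by
  set S : Set ℂ := Metric.closedBall a 1 \ {a}
  have hL : LipschitzOnWith L.toNNReal (slope f a) S := by
    refine LipschitzOnWith.of_dist_le_mul fun z hz w hw => ?_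
    rw [dist_eq_norm, dist_eq_norm]
    refine (h z w hz.2 hw.2 (mem_closedBall_iff_norm.1 hz.1)
      (mem_closedBall_iff_norm.1 hw.1)).trans ?_
    gcongr
    exact Real.le_coe_toNNReal L
  have hc : Cauchy (nhdsWithin a {a}ᶜ) := cauchy_nhds.mono nhdsWithin_le_nhds
  have hS : nhdsWithin a {a}ᶜ ≤ Filter.principal S := by
    rw [Filter.le_principal_iff]
    exact Filter.inter_mem (mem_nhdsWithin_of_mem_nhds (Metric.closedBall_mem_nhds a one_pos))
      self_mem_nhdsWithin
  obtain ⟨d, hd⟩ := cauchy_map_iff_exists_tendsto.1 (hc.map_of_le hL.uniformContinuousOn hS)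
  exact (hasDerivAt_iff_tendsto_slope.2 hd).differentiableAt

/-- A form of Montel's theorem, for the topology of pointwise convergence. -/
lemma isCompact_setOf_entireBound (hp : IsWeight p) {A B : ℝ} (hA : 0 ≤ A) (hB : 0 ≤ B) :
    IsCompact {f | EntireBound p A B f} := by
  obtain ⟨D, E, hD, hE, hsl⟩ := hp.slowly_varying 3
  let L : ℂ → ℝ := fun a => 4 * (A * Real.exp (B * (D * p a + E)))
  -- A compact product of discs is cut by Lipschitz conditions on slopes, each involving three
  -- values of `f` and hence closed; these conditions encode differentiability.
  have hset : {f | EntireBound p A B f} =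
      (Set.univ.pi fun z => Metric.closedBall (0 : ℂ) (A * Real.exp (B * p z))) ∩
      {f | ∀ a z w, z ≠ a → w ≠ a → ‖z - a‖ ≤ 1 → ‖w - a‖ ≤ 1 →
        ‖slope f a z - slope f a w‖ ≤ L a * ‖z - w‖} := by
    ext f
    constructor
    · intro hf
      refine ⟨fun z _ => mem_closedBall_zero_iff.2 (hf.2 z), fun a z w hz hw hz1 hw1 =>
        norm_slope_sub_slope_le hf.1 (fun u hu => (hf.2 u).trans ?_) hz hw hz1 hw1⟩
      gcongr
      exact hsl u a (by simpa using hu)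
    · rintro ⟨h1, h2⟩
      exact ⟨fun a => differentiableAt_of_slope_lipschitz (h2 a),
        fun z => mem_closedBall_zero_iff.1 (h1 z trivial)⟩
  rw [hset]
  refine (isCompact_univ_pi fun z => isCompact_closedBall _ _).inter_right ?_
  simp only [Set.ofPred_forall]
  refine isClosed_iInter fun a => isClosed_iInter fun z => isClosed_iInter fun w =>
    isClosed_iInter fun _ => isClosed_iInter fun _ => isClosed_iInter fun _ =>
    isClosed_iInter fun _ => isClosed_le ?_ continuous_const
  simp only [slope, vsub_eq_sub]
  fun_prop

/-- If every function that equals `w` on a subset of `Γ` and vanishes on the rest of `Γ` is a trace,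
then its one-point pieces are traces with uniform bounds. -/
lemma exists_uniform_of_forall_subset (hp : IsWeight p) {Γ : Set ℂ} (w : ℂ → ℂ)
    (h : ∀ S : Set ℂ, ∃ f ∈ hormanderAlgebra p, (∀ z ∈ Γ, z ∈ S → f z = w z) ∧
      ∀ z ∈ Γ, z ∉ S → f z = 0) :
    ∃ A B : ℝ, 0 < A ∧ 0 < B ∧ ∀ γ ∈ Γ, ∃ f, EntireBound p A B f ∧ f γ = w γ ∧
      ∀ z ∈ Γ, z ≠ γ → f z = 0 := by
  classical
  let K : ℕ → Set (ℂ → ℂ) := fun N => {f | EntireBound p N N f}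
  have hKmem : ∀ f ∈ hormanderAlgebra p, ∃ N : ℕ, f ∈ K N := by
    rintro f ⟨hf, A, B, hA, hB, hb⟩
    obtain ⟨N, hN⟩ := exists_nat_ge (max A B)
    exact ⟨N, EntireBound.mono hp ⟨hf, hb⟩ ((le_max_left _ _).trans hN)
      ((le_max_right _ _).trans hN)⟩
  -- `C N` consists of the subsets of Γ, coded by `Γ → Bool`, whose interpolation problem has a
  -- solution with constants `N`. It is the projection of a compact set, and these sets cover the
  -- Baire space `Γ → Bool`.
  let C : ℕ → Set (Γ → Bool) := fun N =>
    Prod.fst '' ({q : (Γ → Bool) × (ℂ → ℂ) | ∀ γ : Γ, q.2 γ = if q.1 γ then w γ else 0} ∩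
      Set.univ ×ˢ K N)
  have hC : ∀ N, IsClosed (C N) := by
    intro N
    refine IsCompact.isClosed (IsCompact.image ?_ continuous_fst)
    refine IsCompact.inter_left (isCompact_univ.prod
      (isCompact_setOf_entireBound hp N.cast_nonneg N.cast_nonneg)) ?_
    simp only [Set.ofPred_forall]
    refine isClosed_iInter fun γ => isClosed_eq (by fun_prop) ?_
    exact (continuous_of_discreteTopology (f := fun b : Bool => if b then w γ else 0)).comp
      ((continuous_apply γ).comp continuous_fst)
  have hU : ⋃ N, C N = Set.univ := by
    rw [Set.eq_univ_iff_forall]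
    intro x
    obtain ⟨f, hf, h1, h2⟩ := h {z | ∃ hz : z ∈ Γ, x ⟨z, hz⟩ = true}
    obtain ⟨N, hN⟩ := hKmem f hf
    refine Set.mem_iUnion.2 ⟨N, (x, f), ⟨fun γ => ?_, trivial, hN⟩, rfl⟩
    by_cases hx : x γ = true
    · simpa [hx] using h1 γ γ.2 ⟨γ.2, hx⟩
    · simpa [hx] using h2 γ γ.2 (fun ⟨_, h⟩ => hx h)
  obtain ⟨N, x₀, hx₀⟩ := nonempty_interior_of_iUnion_of_closed hC hU
  obtain ⟨I, u, hu, hsub⟩ := isOpen_pi_iff.1 isOpen_interior x₀ hx₀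
  have hone : ∀ γ : Γ, ∃ M : ℕ, ∃ f ∈ K M, f γ = w γ ∧ ∀ z ∈ Γ, z ≠ γ → f z = 0 := by
    intro γ
    obtain ⟨f, hf, h1, h2⟩ := h {(γ : ℂ)}
    obtain ⟨M, hM⟩ := hKmem f hf
    exact ⟨M, f, hM, h1 γ γ.2 rfl, fun z hz hne => h2 z hz hne⟩
  choose M hM using hone
  have hbase : ∀ x : Γ → Bool, (∀ i ∈ I, x i = x₀ i) →
      ∃ f ∈ K N, ∀ γ : Γ, f γ = if x γ then w γ else 0 := by
    intro x hx
    have : x ∈ C N := interior_subset (hsub fun i hi => by rw [hx i hi]; exact (hu i hi).2)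
    obtain ⟨⟨y, f⟩, ⟨h1, -, h2⟩, rfl⟩ := this
    exact ⟨f, h2, h1⟩
  -- `2 * N` serves the difference of two functions of `K N`, used at points outside the finite set
  -- `I`; the sum serves the points of `I`.
  set R : ℝ := 2 * N + 1 + ∑ i ∈ I, (M i : ℝ) with hR
  have hsum : 0 ≤ ∑ i ∈ I, (M i : ℝ) := by positivity
  have hN0 : (0 : ℝ) ≤ N := N.cast_nonneg
  refine ⟨R, R, by positivity, by positivity, fun γ hγ => ?_⟩
  by_cases hI : (⟨γ, hγ⟩ : Γ) ∈ I
  · obtain ⟨f, hf, h1, h2⟩ := hM ⟨γ, hγ⟩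
    have hle : (M ⟨γ, hγ⟩ : ℝ) ≤ R := by
      have := Finset.single_le_sum (f := fun i => (M i : ℝ)) (fun _ _ => Nat.cast_nonneg _) hI
      linarith
    exact ⟨f, EntireBound.mono hp hf hle hle, h1, h2⟩
  -- Outside `I` the coordinate at `γ` is free: solve with `γ` switched on and off and subtract,
  -- which leaves `w γ` at `γ` alone.
  · obtain ⟨f, hf, hf'⟩ := hbase (Function.update x₀ ⟨γ, hγ⟩ true) fun i hi =>
      Function.update_of_ne (fun h : i = ⟨γ, hγ⟩ => hI (h ▸ hi)) _ _
    obtain ⟨g, hg, hg'⟩ := hbase (Function.update x₀ ⟨γ, hγ⟩ false) fun i hi =>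
      Function.update_of_ne (fun h : i = ⟨γ, hγ⟩ => hI (h ▸ hi)) _ _
    refine ⟨fun z => f z - g z, ?_, ?_, fun z hz hne => ?_⟩
    · refine EntireBound.mono hp (A := 2 * N) (B := N)
        ⟨hf.1.sub hg.1, fun z => (norm_sub_le _ _).trans ?_⟩ (by linarith) (by linarith)
      linarith [hf.2 z, hg.2 z]
    · simpa using congrArg₂ (· - ·) (hf' ⟨γ, hγ⟩) (hg' ⟨γ, hγ⟩)
    · have hne' : (⟨z, hz⟩ : Γ) ≠ ⟨γ, hγ⟩ := fun h => hne (congrArg Subtype.val h)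
      have h1 := hf' ⟨z, hz⟩
      have h2 := hg' ⟨z, hz⟩
      rw [Function.update_of_ne hne'] at h1 h2
      simp only at h1 h2
      simp only [h1, h2, sub_self]

/-! ### Interpolating sets: peaks, separation and series -/

lemma IsInterpolating.exists_eqOn {Γ : Set ℂ} (hΓ : IsInterpolating p Γ) {F : ℂ → ℂ} {A B : ℝ}
    (hA : 0 < A) (hB : 0 < B) (hF : ∀ γ ∈ Γ, ‖F γ‖ ≤ A * Real.exp (B * p γ)) :
    ∃ f ∈ hormanderAlgebra p, ∀ γ ∈ Γ, f γ = F γ := by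
  have : (fun γ : Γ => F γ) ∈ sequenceSpace p Γ := ⟨A, B, hA, hB, fun γ => hF γ γ.2⟩
  rw [← hΓ] at this
  obtain ⟨f, hf, h⟩ := this
  exact ⟨f, hf, fun γ hγ => congrFun h ⟨γ, hγ⟩⟩

lemma isInterpolating_of_exists {Γ : Set ℂ}
    (h : ∀ (F : ℂ → ℂ) (A B : ℝ), 0 < A → 0 < B → (∀ γ ∈ Γ, ‖F γ‖ ≤ A * Real.exp (B * p γ)) →
      ∃ f ∈ hormanderAlgebra p, ∀ γ ∈ Γ, f γ = F γ) : IsInterpolating p Γ := by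
  classical
  apply Set.Subset.antisymm
  · rintro _ ⟨f, ⟨-, A, B, hA, hB, hf⟩, rfl⟩
    exact ⟨A, B, hA, hB, fun l => hf l⟩
  · rintro ω ⟨A, B, hA, hB, hω⟩
    obtain ⟨f, hf, hfe⟩ := h (fun z => if hz : z ∈ Γ then ω ⟨z, hz⟩ else 0) A B hA hB
      fun γ hγ => by simpa [hγ] using hω ⟨γ, hγ⟩
    exact ⟨f, hf, funext fun l => by simpa using hfe l l.2⟩

lemma IsInterpolating.subset {Γ Γ' : Set ℂ} (hΓ : IsInterpolating p Γ) (h : Γ' ⊆ Γ) :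
    IsInterpolating p Γ' := by
  classical
  refine isInterpolating_of_exists fun F A B hA hB hF => ?_
  obtain ⟨f, hf, hfe⟩ := hΓ.exists_eqOn (F := fun z => if z ∈ Γ' then F z else 0) hA hB
    fun γ _ => by
      by_cases hγ : γ ∈ Γ'
      · simpa [hγ] using hF γ hγ
      · simp only [hγ, if_false, norm_zero]
        positivity
  exact ⟨f, hf, fun γ hγ => by simpa [hγ] using hfe γ (h hγ)⟩

/-- The uniformity principle is applied to the values exp(M p), which are admissible data;
normalising to 1 at γ then gains the factor exp(-M p(γ)). -/
lemma IsInterpolating.exists_peak (hp : IsWeight p) {Γ : Set ℂ} (hΓ : IsInterpolating p Γ) {M : ℝ}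
    (hM : 0 < M) : ∃ A B : ℝ, 0 < A ∧ 0 < B ∧ ∀ γ ∈ Γ, ∃ h,
      EntireBound p (A * Real.exp (-(M * p γ))) B h ∧ h γ = 1 ∧ ∀ z ∈ Γ, z ≠ γ → h z = 0 := by
  classical
  obtain ⟨A, B, hA, hB, h⟩ := exists_uniform_of_forall_subset hp (Γ := Γ)
    (fun z => (Real.exp (M * p z) : ℂ)) fun S => by
      obtain ⟨f, hf, hfe⟩ := hΓ.exists_eqOn one_pos hM
        (F := fun z => if z ∈ S then (Real.exp (M * p z) : ℂ) else 0) fun γ _ => by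
          by_cases hγ : γ ∈ S
          · simp only [hγ, if_true, Complex.norm_real, Real.norm_eq_abs, Real.abs_exp, one_mul,
              le_refl]
          · simp only [hγ, if_false, norm_zero]
            positivity
      exact ⟨f, hf, fun z hz hS => by simpa only [hS, if_true] using hfe z hz,
        fun z hz hS => by simpa only [hS, if_false] using hfe z hz⟩
  refine ⟨A, B, hA, hB, fun γ hγ => ?_⟩
  obtain ⟨f, hf, h1, h0⟩ := h γ hγ
  refine ⟨fun z => (Real.exp (-(M * p γ)) : ℂ) * f z, ⟨hf.1.const_mul _, fun z => ?_⟩, ?_, ?_⟩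
  · rw [norm_mul, Complex.norm_real, Real.norm_eq_abs, Real.abs_exp, mul_comm A, mul_assoc]
    gcongr
    exact hf.2 z
  · simp only [h1]
    rw [← Complex.ofReal_mul, ← Real.exp_add]
    simp
  · intro z hz hne
    simp only [h0 z hz hne, mul_zero]

/-- The peak at γ equals 1 there and vanishes at γ', so the Schwarz lemma with one zero bounds the
distance from below. -/
lemma IsInterpolating.exists_separation (hp : IsWeight p) {Γ : Set ℂ}
    (hΓ : IsInterpolating p Γ) : ∃ ε C : ℝ, 0 < ε ∧ ε ≤ 1 ∧ 0 < C ∧ ∀ γ ∈ Γ, ∀ γ' ∈ Γ, γ ≠ γ' →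
      ε * Real.exp (-(C * p γ)) ≤ ‖γ - γ'‖ := by
  obtain ⟨A, B, hA, hB, h⟩ := hΓ.exists_peak hp one_pos
  obtain ⟨D, E, hD, hE, hsl⟩ := hp.slowly_varying 2
  refine ⟨min 1 (1 / (A * Real.exp (B * E))), B * D, by positivity, min_le_left _ _,
    by positivity, fun γ hγ γ' hγ' hne => ?_⟩
  have hpγ := hp.nonneg γ
  rcases le_total ‖γ - γ'‖ 1 with h1 | h1
  · obtain ⟨f, hf, hf1, hf0⟩ := h γ hγ
    have := norm_le_mul_prod_of_zeros (M := A * Real.exp (B * (D * p γ + E))) γ {γ'} f hf.1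
      (fun z hz => ?_) (by simpa using hf0 γ' hγ' hne.symm) (by simpa [norm_sub_rev] using h1)
    · rw [hf1, norm_one, Finset.prod_singleton, mul_add, Real.exp_add] at this
      calc min 1 (1 / (A * Real.exp (B * E))) * Real.exp (-(B * D * p γ)) ≤
          1 / (A * Real.exp (B * E)) * Real.exp (-(B * D * p γ)) := by
            gcongr
            exact min_le_right _ _
        _ = 1 / (A * (Real.exp (B * (D * p γ)) * Real.exp (B * E))) := by
            rw [Real.exp_neg, mul_assoc B]
            field_simp
        _ ≤ ‖γ - γ'‖ := by
            rw [div_le_iff₀ (by positivity), mul_comm]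
            exact this
    · refine (hf.2 z).trans ?_
      have h2 : Real.exp (-(1 * p γ)) ≤ 1 := Real.exp_le_one_iff.2 (by linarith)
      have h3 := hsl z γ (by simpa using hz)
      calc A * Real.exp (-(1 * p γ)) * Real.exp (B * p z) ≤ A * 1 * Real.exp (B * p z) := by gcongr
        _ ≤ A * Real.exp (B * (D * p γ + E)) := by rw [mul_one]; gcongr
  · refine le_trans ?_ h1
    refine mul_le_one₀ (min_le_left _ _) (Real.exp_pos _).le (Real.exp_le_one_iff.2 ?_)
    have : 0 ≤ B * D * p γ := by positivity
    linarith

/-- Discs of radius (ε/2) exp(-C p(γ)) about the points are disjoint, and the integrals of (1 +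
|z|)^(-3) over them add up to at most the integral over the plane. -/
lemma summable_exp_of_separated (hp : IsWeight p) {Γ : Set ℂ} {ε C : ℝ} (hε : 0 < ε)
    (hε1 : ε ≤ 1) (hC : 0 < C)
    (hs : ∀ γ ∈ Γ, ∀ γ' ∈ Γ, γ ≠ γ' → ε * Real.exp (-(C * p γ)) ≤ ‖γ - γ'‖) :
    ∃ M : ℝ, 0 < M ∧ Summable fun γ : Γ => Real.exp (-(M * p γ)) := by
  obtain ⟨κ, hκ, hgr⟩ := hp.growth
  have hint : MeasureTheory.Integrable fun z : ℂ => (1 + ‖z‖) ^ (-(3 : ℝ)) :=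
    integrable_one_add_norm (by rw [Complex.finrank_real_complex]; norm_num)
  set I := ∫ z : ℂ, (1 + ‖z‖) ^ (-(3 : ℝ))
  set c : ℝ := Real.pi * (ε / 2) ^ 2 / 27 with hc
  have hc0 : 0 < c := by positivity
  -- `2 * C` comes from the area of the disc. `3 * κ`, and the 27 in `c`, come from cubing `1 + ‖z‖
  -- ≤ 3 * exp (κ * p γ)`.
  refine ⟨2 * C + 3 * κ, by positivity, summable_of_sum_le (c := I / c)
    (fun γ => (Real.exp_pos _).le) fun u => ?_⟩
  rw [le_div_iff₀ hc0, Finset.sum_mul]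
  set r : Γ → ℝ := fun γ => ε / 2 * Real.exp (-(C * p γ)) with hr
  have hr0 : ∀ γ, 0 < r γ := fun γ => by positivity
  have hr1 : ∀ γ, r γ ≤ 1 := fun γ => by
    have h1 : Real.exp (-(C * p γ)) ≤ 1 := Real.exp_le_one_iff.2 (by
      have := mul_nonneg hC.le (hp.nonneg γ); linarith)
    have := Real.exp_pos (-(C * p γ))
    simp only [hr]
    nlinarith
  have hdisj : Set.Pairwise (↑u) (Function.onFun Disjoint fun γ : Γ => Metric.ball (γ : ℂ) (r γ)) := by
    intro γ _ γ' _ hne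
    refine Metric.ball_disjoint_ball ?_
    have hne' : (γ : ℂ) ≠ γ' := fun h => hne (Subtype.ext h)
    have h1 := hs γ γ.2 γ' γ'.2 hne'
    have h2 := hs γ' γ'.2 γ γ.2 hne'.symm
    rw [norm_sub_rev] at h2
    rw [dist_eq_norm]
    simp only [hr]
    linarith
  calc ∑ γ ∈ u, Real.exp (-((2 * C + 3 * κ) * p γ)) * c
      ≤ ∑ γ ∈ u, ∫ z in Metric.ball (γ : ℂ) (r γ), (1 + ‖z‖) ^ (-(3 : ℝ)) := by
        refine Finset.sum_le_sum fun γ _ => ?_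
        have hlow : ∀ z ∈ Metric.ball (γ : ℂ) (r γ),
            Real.exp (-(3 * κ * p γ)) / 27 ≤ (1 + ‖z‖) ^ (-(3 : ℝ)) := by
          intro z hz
          have h1 : ‖z - γ‖ < 1 := (mem_ball_iff_norm.1 hz).trans_le (hr1 γ)
          have h2 : ‖z‖ ≤ ‖(γ : ℂ)‖ + 1 := by
            have := norm_sub_norm_le z (γ : ℂ)
            linarith
          have h3 : 1 + ‖z‖ ≤ 3 * Real.exp (κ * p γ) := by
            nlinarith [hgr γ, sq_nonneg (‖(γ : ℂ)‖ - 1), norm_nonneg (γ : ℂ)]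
          have h4 : Real.exp (-(3 * κ * p γ)) / 27 = (3 * Real.exp (κ * p γ)) ^ (-(3 : ℝ)) := by
            rw [Real.rpow_neg (by positivity), show (3 : ℝ) = ((3 : ℕ) : ℝ) by norm_num,
              Real.rpow_natCast, mul_pow, ← Real.exp_nat_mul, Real.exp_neg]
            push_cast
            rw [mul_assoc]
            field_simp
            norm_num
          rw [h4]
          exact Real.rpow_le_rpow_of_nonpos (by positivity) h3 (by norm_num)
        have hvol : MeasureTheory.volume.real (Metric.ball (γ : ℂ) (r γ)) =
            Real.pi * r γ ^ 2 := by
          rw [MeasureTheory.measureReal_def, Complex.volume_ball, ENNReal.toReal_mul,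
            ENNReal.toReal_pow, ENNReal.toReal_ofReal (hr0 γ).le, mul_comm]
          rfl
        have h5 := MeasureTheory.setIntegral_mono_on (μ := MeasureTheory.volume)
          (s := Metric.ball (γ : ℂ) (r γ))
          (f := fun _ => Real.exp (-(3 * κ * p γ)) / 27) (by
            refine MeasureTheory.integrableOn_const ?_
            exact MeasureTheory.measure_ball_lt_top.ne) hint.integrableOn
          Metric.isOpen_ball.measurableSet hlow
        rw [MeasureTheory.setIntegral_const, hvol, smul_eq_mul] at h5
        refine le_of_eq_of_le ?_ h5
        simp only [hr, hc]
        rw [mul_pow, ← Real.exp_nat_mul, show -((2 * C + 3 * κ) * p γ) =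
          ((2 : ℕ) : ℝ) * -(C * p γ) + -(3 * κ * p γ) by push_cast; ring, Real.exp_add]
        ring
    _ = ∫ z in ⋃ γ ∈ u, Metric.ball (γ : ℂ) (r γ), (1 + ‖z‖) ^ (-(3 : ℝ)) :=
        (MeasureTheory.integral_biUnion_finset u (fun γ _ => Metric.isOpen_ball.measurableSet) hdisj
          fun γ _ => hint.integrableOn).symm
    _ ≤ I := MeasureTheory.setIntegral_le_integral hint
        (Filter.Eventually.of_forall fun z => by positivity)

/-- Interpolation on `Γ` by a series whose terms are multiples of prescribed functions `q γ`. -/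
lemma IsInterpolating.exists_series (hp : IsWeight p) {Γ : Set ℂ} (hΓ : IsInterpolating p Γ)
    {B : ℝ} (hB : 0 < B) : ∃ A' B' : ℝ, 0 < A' ∧ 0 < B' ∧ ∀ A : ℝ, 0 ≤ A → ∀ q : Γ → ℂ → ℂ,
      (∀ γ : Γ, EntireBound p (A * Real.exp (B * p γ)) B (q γ)) →
      ∃ f, EntireBound p (A * A') B' f ∧ (∀ γ : Γ, f γ = q γ γ) ∧
        ∀ z, (∀ γ : Γ, q γ z = 0) → f z = 0 := by
  obtain ⟨ε, C, hε, hε1, hC, hs⟩ := hΓ.exists_separation hp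
  obtain ⟨M, hM, hsum⟩ := summable_exp_of_separated hp hε hε1 hC hs
  -- The part `B` of the decay absorbs the growth of `q γ` in γ; the part `M` makes the series
  -- converge.
  obtain ⟨A₁, B₁, hA₁, hB₁, h⟩ := hΓ.exists_peak hp (M := M + B) (by positivity)
  obtain ⟨D, E, hD, hE, hsl⟩ := hp.slowly_varying 1
  choose k hk hk1 hk0 using fun γ : Γ => h γ γ.2
  set S := ∑' γ : Γ, Real.exp (-(M * p γ))
  have hS : 0 ≤ S := tsum_nonneg fun _ => (Real.exp_pos _).le
  refine ⟨A₁ * (S + 1), B + B₁, by positivity, by positivity, fun A hA q hq => ?_⟩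
  have hterm : ∀ (γ : Γ) z, ‖q γ z * k γ z‖ ≤
      A * A₁ * Real.exp ((B + B₁) * p z) * Real.exp (-(M * p γ)) := by
    intro γ z
    rw [norm_mul]
    calc ‖q γ z‖ * ‖k γ z‖ ≤ (A * Real.exp (B * p γ) * Real.exp (B * p z)) *
          (A₁ * Real.exp (-((M + B) * p γ)) * Real.exp (B₁ * p z)) :=
          mul_le_mul ((hq γ).2 z) ((hk γ).2 z) (norm_nonneg _) (by positivity)
      _ = A * A₁ * (Real.exp (B * p γ) * Real.exp (B * p z) * Real.exp (-((M + B) * p γ)) *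
          Real.exp (B₁ * p z)) := by ring
      _ = A * A₁ * (Real.exp ((B + B₁) * p z) * Real.exp (-(M * p γ))) := by
          simp only [← Real.exp_add]
          congr 2
          ring
      _ = _ := by ring
  refine ⟨fun z => ∑' γ : Γ, q γ z * k γ z, ⟨fun z₀ => ?_, fun z => ?_⟩, fun γ => ?_,
    fun z hz => ?_⟩
  · have hd : DifferentiableOn ℂ (fun z => ∑' γ : Γ, q γ z * k γ z) (Metric.ball z₀ 1) := by
      refine Complex.differentiableOn_tsum_of_summable_norm
        (u := fun γ : Γ => A * A₁ * Real.exp ((B + B₁) * (D * p z₀ + E)) *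
          Real.exp (-(M * p γ)))
        (hsum.mul_left _) (fun γ => ((hq γ).1.mul (hk γ).1).differentiableOn)
        Metric.isOpen_ball fun γ z hz => (hterm γ z).trans ?_
      have := hsl z z₀ (by simpa using (mem_ball_iff_norm.1 hz).le)
      gcongr
    exact hd.differentiableAt (Metric.ball_mem_nhds z₀ one_pos)
  · refine (tsum_of_norm_bounded (hsum.hasSum.mul_left _) fun γ => hterm γ z).trans ?_
    have : 0 ≤ A * A₁ * Real.exp ((B + B₁) * p z) := by positivity
    calc _ = A * A₁ * Real.exp ((B + B₁) * p z) * S := rfl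
      _ ≤ A * A₁ * Real.exp ((B + B₁) * p z) * (S + 1) := by gcongr; linarith
      _ = _ := by ring
  · simp only
    rw [tsum_eq_single γ fun γ' hne => ?_, hk1, mul_one]
    rw [hk0 γ' γ γ.2 fun h => hne (Subtype.ext h.symm), mul_zero]
  · simp only [hz, zero_mul, tsum_zero]

/-! ### Unions of interpolating sets: extending one set at a time -/

lemma IsWeight.norm_le_exp (hp : IsWeight p) :
    ∃ κ : ℝ, 0 < κ ∧ ∀ z w : ℂ, ‖z - w‖ ≤ 2 * Real.exp (κ * p z + κ * p w) := by
  obtain ⟨κ, hκ, h⟩ := hp.growth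
  refine ⟨κ, hκ, fun z w => (norm_sub_le _ _).trans ?_⟩
  have key : ∀ u, ‖u‖ ≤ Real.exp (κ * p u) := fun u => by
    nlinarith [h u, sq_nonneg (‖u‖ - 1), norm_nonneg u]
  have hz := mul_nonneg hκ.le (hp.nonneg z)
  have hw := mul_nonneg hκ.le (hp.nonneg w)
  have h1 : Real.exp (κ * p z) ≤ Real.exp (κ * p z + κ * p w) := Real.exp_le_exp.2 (by linarith)
  have h2 : Real.exp (κ * p w) ≤ Real.exp (κ * p z + κ * p w) := Real.exp_le_exp.2 (by linarith)
  linarith [key z, key w]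

/-- Off `U`, there are functions vanishing on `U` which are at least as large, at a prescribed
point `l` of `Λ`, as the product of the distances from `l` to at most `k` points of `U`. -/
def HasVanishingFunctions (p : ℂ → ℝ) (Λ U : Set ℂ) (k : ℕ) : Prop :=
  ∃ A B : ℝ, 0 < A ∧ 0 < B ∧ ∀ l ∈ Λ, l ∉ U → ∃ T : Finset ℂ, ↑T ⊆ U ∧ T.card ≤ k ∧
    (∀ t ∈ T, ‖t - l‖ ≤ 1) ∧ ∃ G, EntireBound p (A * Real.exp (B * p l)) B G ∧
      (∀ u ∈ U, G u = 0) ∧ G l = ∏ t ∈ T, (l - t)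

lemma hasVanishingFunctions_empty (hp : IsWeight p) (Λ : Set ℂ) :
    HasVanishingFunctions p Λ ∅ 0 := by
  refine ⟨1, 1, one_pos, one_pos, fun l _ _ => ⟨∅, by simp, by simp, by simp, fun _ => 1,
    ⟨differentiable_const _, fun z => ?_⟩, by simp, by simp⟩⟩
  rw [norm_one, one_mul, ← Real.exp_add]
  exact Real.one_le_exp (by linarith [hp.nonneg l, hp.nonneg z])

/-- Take G(z) = P - (z - l) g(z), where g interpolates P/(γ - l) on Γ. With P = l - t for a nearest
point t within distance 1, and P = 1 if there is none, these data are bounded by 1, so the constants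
do not depend on l. -/
lemma IsInterpolating.hasVanishingFunctions (hp : IsWeight p) {Λ Γ : Set ℂ}
    (hΓ : IsInterpolating p Γ) (hfin : ∀ c R, (Γ ∩ Metric.closedBall c R).Finite) :
    HasVanishingFunctions p Λ Γ 1 := by
  obtain ⟨A, B, hA, hB, h⟩ := hΓ.exists_series hp one_pos
  obtain ⟨κ, hκ, hκ'⟩ := hp.norm_le_exp
  refine ⟨1 + 2 * A, κ + B, by positivity, by positivity, fun l _ hlΓ => ?_⟩
  obtain ⟨T, hTΓ, hT1, hTl, hTP⟩ : ∃ T : Finset ℂ, ↑T ⊆ Γ ∧ T.card ≤ 1 ∧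
      (∀ t ∈ T, ‖t - l‖ ≤ 1) ∧ ∀ γ ∈ Γ, ‖∏ t ∈ T, (l - t)‖ ≤ ‖γ - l‖ := by
    rcases (Γ ∩ Metric.closedBall l 1).eq_empty_or_nonempty with he | hne
    · refine ⟨∅, by simp, by simp, by simp, fun γ hγ => ?_⟩
      by_contra hlt
      simp only [Finset.prod_empty, norm_one, not_le] at hlt
      exact (he.subset ⟨hγ, mem_closedBall_iff_norm.2 hlt.le⟩ : γ ∈ (∅ : Set ℂ))
    · obtain ⟨t, ht, hmin⟩ := Set.exists_min_image _ (fun γ => ‖γ - l‖) (hfin l 1) hne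
      have htl := mem_closedBall_iff_norm.1 ht.2
      refine ⟨{t}, by simpa using ht.1, by simp, by simpa using htl, fun γ hγ => ?_⟩
      rw [Finset.prod_singleton, norm_sub_rev]
      by_cases hγl : ‖γ - l‖ ≤ 1
      · exact hmin γ ⟨hγ, mem_closedBall_iff_norm.2 hγl⟩
      · exact htl.trans (not_le.1 hγl).le
  set P := ∏ t ∈ T, (l - t) with hP
  have hP1 : ‖P‖ ≤ 1 := by
    rw [hP, norm_prod]
    refine Finset.prod_le_one (fun _ _ => norm_nonneg _) fun t ht => ?_
    rw [norm_sub_rev]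
    exact hTl t ht
  obtain ⟨g, hg, hgΓ, -⟩ := h 1 zero_le_one (fun γ _ => P / (γ - l)) fun γ =>
    ⟨differentiable_const _, fun z => by
      have hne : (γ : ℂ) - l ≠ 0 := sub_ne_zero.2 fun h => hlΓ (h ▸ γ.2)
      have h1 : ‖P / (γ - l)‖ ≤ 1 := by
        rw [norm_div, div_le_one (norm_pos_iff.2 hne)]
        exact hTP γ γ.2
      refine h1.trans ?_
      rw [one_mul, ← Real.exp_add]
      exact Real.one_le_exp (by linarith [hp.nonneg γ, hp.nonneg z])⟩
  refine ⟨T, hTΓ, hT1, hTl, fun z => P - (z - l) * g z,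
    ⟨(differentiable_const P).sub ((differentiable_id.sub_const l).mul hg.1), fun z => ?_⟩,
    fun u hu => ?_, by simp [hP]⟩
  · refine (norm_sub_le _ _).trans ?_
    rw [norm_mul]
    have h1 : ‖z - l‖ * ‖g z‖ ≤ (2 * Real.exp (κ * p z + κ * p l)) *
        (1 * A * Real.exp (B * p z)) :=
      mul_le_mul (hκ' z l) (hg.2 z) (norm_nonneg _) (by positivity)
    have hl := hp.nonneg l
    have hz := hp.nonneg z
    have h2 : (1 : ℝ) ≤ Real.exp ((κ + B) * p l) * Real.exp ((κ + B) * p z) := by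
      rw [← Real.exp_add]
      exact Real.one_le_exp (by positivity)
    have h3 : (2 * Real.exp (κ * p z + κ * p l)) * (1 * A * Real.exp (B * p z)) ≤
        2 * A * (Real.exp ((κ + B) * p l) * Real.exp ((κ + B) * p z)) := by
      have : (2 * Real.exp (κ * p z + κ * p l)) * (1 * A * Real.exp (B * p z)) =
          2 * A * Real.exp (κ * p z + κ * p l + B * p z) := by rw [Real.exp_add _ (B * p z)]; ring
      rw [this, ← Real.exp_add]
      refine mul_le_mul_of_nonneg_left (Real.exp_le_exp.2 ?_) (by positivity)
      nlinarith [mul_nonneg hB.le hl]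
    linarith
  · have hne : u - l ≠ 0 := sub_ne_zero.2 fun h => hlΓ (h ▸ hu)
    have := hgΓ ⟨u, hu⟩
    simp only at this
    simp only [this]
    field_simp
    ring

lemma HasVanishingFunctions.union {Λ U V : Set ℂ} {j k : ℕ}
    (hU : HasVanishingFunctions p Λ U j) (hV : HasVanishingFunctions p Λ V k)
    (hUV : Disjoint U V) : HasVanishingFunctions p Λ (U ∪ V) (j + k) := by
  obtain ⟨A, B, hA, hB, h⟩ := hU
  obtain ⟨A', B', hA', hB', h'⟩ := hV
  refine ⟨A * A', B + B', by positivity, by positivity, fun l hl hlUV => ?_⟩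
  rw [Set.mem_union, not_or] at hlUV
  obtain ⟨T, hTU, hTc, hTl, G, hG, hG0, hGl⟩ := h l hl hlUV.1
  obtain ⟨T', hTU', hTc', hTl', G', hG', hG0', hGl'⟩ := h' l hl hlUV.2
  have hTT : Disjoint T T' := Finset.disjoint_coe.1 (hUV.mono hTU hTU')
  refine ⟨T ∪ T', ?_, ?_, fun t ht => ?_, fun z => G z * G' z,
    ⟨hG.1.mul hG'.1, fun z => ?_⟩, fun u hu => ?_, ?_⟩
  · rw [Finset.coe_union]
    exact Set.union_subset_union hTU hTU'
  · exact (Finset.card_union_le _ _).trans (add_le_add hTc hTc')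
  · exact (Finset.mem_union.1 ht).elim (hTl t) (hTl' t)
  · rw [norm_mul]
    refine (mul_le_mul (hG.2 z) (hG'.2 z) (norm_nonneg _) (by positivity)).trans_eq ?_
    rw [add_mul, add_mul, Real.exp_add, Real.exp_add]
    ring
  · rcases hu with hu | hu
    · simp only [hG0 u hu, zero_mul]
    · simp only [hG0' u hu, mul_zero]
  · simp only [hGl, hGl', Finset.prod_union hTT]

lemma HasBoundedDifferences.uniform {Λ : Set ℂ} {m : ℕ} {F : ℂ → ℂ} (hp : IsWeight p)
    (hF : HasBoundedDifferences p Λ m F) : ∃ A B : ℝ, 0 < A ∧ 0 < B ∧ ∀ s : Finset ℂ, ↑s ⊆ Λ →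
      s.Nonempty → s.card ≤ m + 1 → ‖nodeDifference F s‖ ≤ A * Real.exp (B * ∑ a ∈ s, p a) := by
  choose! A B hA hB h using fun k (hk : k ≤ m) => hF.mono hp hk
  have hsum : ∀ (X : ℕ → ℝ), (∀ k ≤ m, 0 < X k) → ∀ k ≤ m, X k ≤ ∑ i ∈ Finset.range (m + 1), X i :=
    fun X hX k hk => Finset.single_le_sum (f := X)
      (fun i hi => (hX i (by simpa [Nat.lt_succ_iff] using hi)).le)
      (by simpa [Nat.lt_succ_iff] using hk)
  refine ⟨∑ i ∈ Finset.range (m + 1), A i, ∑ i ∈ Finset.range (m + 1), B i,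
    (hA 0 m.zero_le).trans_le (hsum A hA 0 m.zero_le),
    (hB 0 m.zero_le).trans_le (hsum B hB 0 m.zero_le), fun s hs hne hc => ?_⟩
  have hpos := hne.card_pos
  have hk : s.card - 1 ≤ m := by omega
  refine (h _ hk s hs (by omega)).trans ?_
  have hS : 0 ≤ ∑ a ∈ s, p a := Finset.sum_nonneg fun b _ => hp.nonneg b
  have h1 := hsum A hA _ hk
  have h2 := hsum B hB _ hk
  have h3 := (hA _ hk).trans_le h1
  gcongr

/-- The error `v = F - f` vanishes on `U`, so `v γ / ∏ (γ - t)` over `T γ` is a divided difference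
of `v`, bounded because `T γ` has at most `m` points. Multiplied by `G γ` it gives a function
vanishing on `U` with value `v γ` at γ, and these functions are summed by `exists_series`. -/
lemma exists_extension (hp : IsWeight p) {Λ U Γ : Set ℂ} {F f : ℂ → ℂ} {k m : ℕ} (hkm : k ≤ m)
    (hF : HasBoundedDifferences p Λ m F) (hUΛ : U ⊆ Λ) (hU : HasVanishingFunctions p Λ U k)
    (hΓΛ : Γ ⊆ Λ) (hΓ : IsInterpolating p Γ) (hUΓ : Disjoint U Γ)
    (hf : f ∈ hormanderAlgebra p) (hfF : ∀ u ∈ U, f u = F u) :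
    ∃ g ∈ hormanderAlgebra p, ∀ u ∈ U ∪ Γ, g u = F u := by
  obtain ⟨A, B, hA, hB, hv⟩ := (hF.sub hp (hasBoundedDifferences_of_mem hp Λ m hf)).uniform hp
  obtain ⟨A₁, B₁, hA₁, hB₁, hG⟩ := hU
  obtain ⟨D, E, hD, hE, hsl⟩ := hp.slowly_varying 1
  set v : ℂ → ℂ := fun z => F z - f z with hvdef
  have hnot : ∀ γ : Γ, (γ : ℂ) ∉ U := fun γ hγ => Set.disjoint_left.1 hUΓ hγ γ.2
  choose T hTU hTc hTl G hG hG0 hGl using fun γ : Γ => hG γ (hΓΛ γ.2) (hnot γ)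
  have hγT : ∀ γ : Γ, (γ : ℂ) ∉ T γ := fun γ h => hnot γ (hTU γ h)
  set B₂ : ℝ := B * (1 + m * D) + B₁ with hB₂
  obtain ⟨A₃, B₃, hA₃, hB₃, hser⟩ := hΓ.exists_series hp (B := B₂) (by positivity)
  have hcoef : ∀ γ : Γ, ‖v γ / ∏ t ∈ T γ, ((γ : ℂ) - t)‖ ≤
      A * Real.exp (B * m * E) * Real.exp (B * (1 + m * D) * p γ) := by
    intro γ
    have hzero : ∀ b ∈ T γ, v b = 0 := fun b hb => by simp [hvdef, hfF b (hTU γ hb)]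
    rw [← nodeDifference_insert_of_eq_zero (hγT γ) hzero, mul_assoc, ← Real.exp_add]
    refine (hv _ ?_ (Finset.insert_nonempty _ _) ?_).trans ?_
    · rw [Finset.coe_insert, Set.insert_subset_iff]
      exact ⟨hΓΛ γ.2, (hTU γ).trans hUΛ⟩
    · rw [Finset.card_insert_of_notMem (hγT γ)]
      have := hTc γ
      omega
    · have hpγ := hp.nonneg γ
      -- The nodes lie within distance 1 of γ, so their weights are controlled by `p γ` alone.
      have h1 : ∑ t ∈ T γ, p t ≤ m * (D * p γ + E) := by
        refine (Finset.sum_le_card_nsmul _ _ (D * p γ + E) fun t ht =>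
          hsl t γ (by simpa using hTl γ t ht)).trans ?_
        rw [nsmul_eq_mul]
        gcongr
        exact_mod_cast (hTc γ).trans hkm
      rw [Finset.sum_insert (hγT γ)]
      gcongr
      calc B * (p γ + ∑ t ∈ T γ, p t) ≤ B * (p γ + m * (D * p γ + E)) := by gcongr
        _ = _ := by ring
  obtain ⟨g, hg, hgΓ, hg0⟩ := hser (A * Real.exp (B * m * E) * A₁) (by positivity)
    (fun γ z => v γ / (∏ t ∈ T γ, ((γ : ℂ) - t)) * G γ z) fun γ => by
      refine ⟨(hG γ).1.const_mul _, fun z => ?_⟩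
      rw [norm_mul]
      refine (mul_le_mul (hcoef γ) ((hG γ).2 z) (norm_nonneg _) (by positivity)).trans ?_
      have hz := hp.nonneg z
      have h1 : Real.exp (B₁ * p z) ≤ Real.exp (B₂ * p z) := by
        refine Real.exp_le_exp.2 (mul_le_mul_of_nonneg_right ?_ hz)
        rw [hB₂]
        have : 0 ≤ B * (1 + m * D) := by positivity
        linarith
      have h2 : Real.exp (B₂ * p γ) =
          Real.exp (B * (1 + m * D) * p γ) * Real.exp (B₁ * p γ) := by
        rw [hB₂, add_mul, Real.exp_add]
      rw [h2]
      calc _ = A * Real.exp (B * m * E) * A₁ * (Real.exp (B * (1 + m * D) * p γ) *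
            Real.exp (B₁ * p γ)) * Real.exp (B₁ * p z) := by ring
        _ ≤ _ := by gcongr
  obtain ⟨hfd, A₄, B₄, hA₄, hB₄, hfb⟩ := hf
  refine ⟨fun z => f z + g z, ⟨hfd.add hg.1, A₄ + A * Real.exp (B * m * E) * A₁ * A₃, B₄ + B₃,
    by positivity, by positivity, fun z => ?_⟩, fun u hu => ?_⟩
  · have hz := hp.nonneg z
    rw [add_mul]
    refine (norm_add_le _ _).trans (add_le_add ((hfb z).trans ?_) ((hg.2 z).trans ?_)) <;>
    · gcongr
      linarith
  · by_cases huU : u ∈ U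
    · have : g u = 0 := hg0 u fun γ => by simp only [hG0 γ u huU, mul_zero]
      simp only [this, add_zero, hfF u huU]
    · have huΓ : u ∈ Γ := hu.resolve_left huU
      have h1 := hgΓ ⟨u, huΓ⟩
      simp only [hGl] at h1
      rw [div_mul_cancel₀ _ (prod_sub_ne_zero (hγT ⟨u, huΓ⟩))] at h1
      simp [h1, hvdef]

lemma finite_inter_closedBall {Λ : Set ℂ} (hclosed : IsClosed Λ) (hdiscrete : IsDiscrete Λ)
    (c : ℂ) (R : ℝ) : (Λ ∩ Metric.closedBall c R).Finite := by
  refine IsCompact.finite ?_ (hdiscrete.mono Set.inter_subset_left)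
  exact (isCompact_closedBall c R).inter_left hclosed

lemma traceSpace_eq_of_iUnion (hp : IsWeight p) {Λ : Set ℂ} (hclosed : IsClosed Λ)
    (hdiscrete : IsDiscrete Λ) {n : ℕ} (hn : 1 ≤ n) {Γ : Fin n → Set ℂ}
    (hΓ : ∀ i, IsInterpolating p (Γ i)) (hΛ : Λ = ⋃ i, Γ i) :
    traceSpace p Λ = dividedDifferenceSpace p Λ (n - 1) := by
  classical
  apply Set.Subset.antisymm
  · rintro _ ⟨f, hf, rfl⟩
    exact (mem_dividedDifferenceSpace_iff (F := f) fun _ => rfl).2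
      (hasBoundedDifferences_of_mem hp Λ _ hf)
  intro ω hω
  set F : ℂ → ℂ := fun z => if hz : z ∈ Λ then ω ⟨z, hz⟩ else 0 with hFdef
  have hFω : ∀ l : Λ, F l = ω l := fun l => by simp [hFdef]
  have hF := (mem_dividedDifferenceSpace_iff hFω).1 hω
  have hsub : ∀ i, Γ i ⊆ Λ := fun i => hΛ ▸ Set.subset_iUnion Γ i
  let U : ℕ → Set ℂ := fun k => {z | ∃ i : Fin n, i.val < k ∧ z ∈ Γ i}
  have hUΛ : ∀ k, U k ⊆ Λ := fun k z ⟨i, _, hz⟩ => hsub i hz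
  have key : ∀ k ≤ n, HasVanishingFunctions p Λ (U k) k ∧
      ∃ f ∈ hormanderAlgebra p, ∀ u ∈ U k, f u = F u := by
    intro k
    induction k with
    | zero =>
      intro _
      have hU0 : U 0 = ∅ := by simp [U]
      rw [hU0]
      exact ⟨hasVanishingFunctions_empty hp Λ, fun _ => 0, ⟨differentiable_const _, 1, 1, one_pos,
        one_pos, fun z => by simpa using (Real.exp_pos _).le⟩, by simp⟩
    | succ k ih =>
      intro hk
      obtain ⟨hV, f, hf, hfF⟩ := ih (by omega)
      -- The given sets may overlap; only the points not yet treated are added.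
      set Γ' : Set ℂ := Γ ⟨k, hk⟩ \ U k
      have hΓ' : IsInterpolating p Γ' := (hΓ ⟨k, hk⟩).subset Set.sdiff_subset
      have hΓΛ : Γ' ⊆ Λ := Set.sdiff_subset.trans (hsub _)
      have hU : U (k + 1) = U k ∪ Γ' := by
        ext z
        constructor
        · rintro ⟨i, hi, hz⟩
          by_cases hzU : z ∈ U k
          · exact Or.inl hzU
          · rcases Nat.lt_succ_iff_lt_or_eq.1 hi with hi | hi
            · exact Or.inl ⟨i, hi, hz⟩
            · obtain rfl : i = ⟨k, hk⟩ := Fin.ext hi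
              exact Or.inr ⟨hz, hzU⟩
        · rintro (⟨i, hi, hz⟩ | ⟨hz, -⟩)
          · exact ⟨i, by omega, hz⟩
          · exact ⟨⟨k, hk⟩, by simp, hz⟩
      have hdisj : Disjoint (U k) Γ' := Set.disjoint_sdiff_right
      have hfin : ∀ c R, (Γ' ∩ Metric.closedBall c R).Finite := fun c R =>
        (finite_inter_closedBall hclosed hdiscrete c R).subset
          (Set.inter_subset_inter_left _ hΓΛ)
      rw [hU]
      exact ⟨hV.union (hΓ'.hasVanishingFunctions hp hfin) hdisj,
        exists_extension hp (by omega) hF (hUΛ k) hV hΓΛ hΓ' hdisj hf hfF⟩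
  obtain ⟨-, f, hf, hfF⟩ := key n le_rfl
  refine ⟨f, hf, funext fun l => ?_⟩
  have hl : (l : ℂ) ∈ ⋃ i, Γ i := hΛ ▸ l.2
  obtain ⟨i, hi⟩ := Set.mem_iUnion.1 hl
  simp only
  rw [hfF l ⟨i, i.2, hi⟩, hFω]

/-! ### From the trace identity to interpolating sets: counting and clusters -/

/-- If all values on the nodes agree, the difference is zero. Otherwise split the recursion at two
nodes with different values, where the denominator is bounded below. -/
lemma hasBoundedDifferences_of_separated (hp : IsWeight p) {Λ : Set ℂ} {F : ℂ → ℂ} {A B ε C : ℝ}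
    (hA : 0 < A) (hB : 0 < B) (hε : 0 < ε) (hC : 0 < C)
    (hF : ∀ x ∈ Λ, ‖F x‖ ≤ A * Real.exp (B * p x))
    (hsep : ∀ x ∈ Λ, ∀ y ∈ Λ, F x ≠ F y → ε * Real.exp (-(C * (p x + p y))) ≤ ‖x - y‖) (m : ℕ) :
    HasBoundedDifferences p Λ m F := by
  induction m with
  | zero =>
    refine ⟨A, B, hA, hB, fun s hs hc => ?_⟩
    obtain ⟨a, rfl⟩ := Finset.card_eq_one.1 hc
    simpa [nodeDifference] using hF a (by simpa using hs)
  | succ m ih =>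
    obtain ⟨A', B', hA', hB', h⟩ := ih
    refine ⟨2 * A' / ε, B' + C, by positivity, by positivity, fun s hs hc => ?_⟩
    by_cases hconst : ∀ a ∈ s, ∀ b ∈ s, F a = F b
    · obtain ⟨a, ha⟩ : s.Nonempty := Finset.card_pos.1 (by omega)
      rw [nodeDifference_congr (G := fun _ => F a) fun b hb => hconst b hb a ha,
        nodeDifference_const _ (by omega), norm_zero]
      positivity
    · push Not at hconst
      obtain ⟨a, ha, b, hb, hab⟩ := hconst
      have hne : a ≠ b := fun h => hab (h ▸ rfl)
      set t := (s.erase a).erase b with ht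
      have hb' : b ∈ s.erase a := Finset.mem_erase.2 ⟨hne.symm, hb⟩
      have hs' : s = insert a (insert b t) := by
        rw [ht, Finset.insert_erase hb', Finset.insert_erase ha]
      have hbt : b ∉ t := Finset.notMem_erase b _
      have hat : a ∉ t := fun h => Finset.notMem_erase a s (Finset.mem_of_mem_erase h)
      have htc : t.card = m := by
        rw [ht, Finset.card_erase_of_mem hb', Finset.card_erase_of_mem ha, hc]
        rfl
      have hts : t ⊆ s := (Finset.erase_subset _ _).trans (Finset.erase_subset _ _)
      set S := ∑ c ∈ s, p c with hS
      have hmono : ∀ {u : Finset ℂ}, u ⊆ s → ∑ z ∈ u, p z ≤ S := fun hu =>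
        Finset.sum_le_sum_of_subset_of_nonneg hu fun _ _ _ => hp.nonneg _
      have hins : ∀ c ∈ s, c ∉ t → ‖nodeDifference F (insert c t)‖ ≤ A' * Real.exp (B' * S) := by
        intro c hcs hct
        have hsub : insert c t ⊆ s := Finset.insert_subset hcs hts
        refine (h _ (fun z hz => hs (hsub hz)) ?_).trans ?_
        · rw [Finset.card_insert_of_notMem hct, htc]
        · have := hmono hsub
          gcongr
      have hpab : p a + p b ≤ S := by
        have := hmono (u := {a, b}) (by
          intro z hz
          rcases Finset.mem_insert.1 hz with rfl | hz
          · exact ha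
          · exact Finset.mem_singleton.1 hz ▸ hb)
        rwa [Finset.sum_pair hne] at this
      have hd : ε * Real.exp (-(C * S)) ≤ ‖b - a‖ := by
        rw [norm_sub_rev]
        refine le_trans ?_ (hsep a (hs ha) b (hs hb) hab)
        gcongr
      rw [hs', nodeDifference_insert_insert F hne hat hbt, norm_div]
      calc ‖nodeDifference F (insert b t) - nodeDifference F (insert a t)‖ / ‖b - a‖
          ≤ (A' * Real.exp (B' * S) + A' * Real.exp (B' * S)) / (ε * Real.exp (-(C * S))) := by
            gcongr
            exact (norm_sub_le _ _).trans (add_le_add (hins b hb hbt) (hins a ha hat))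
        _ = 2 * A' / ε * Real.exp ((B' + C) * S) := by
            rw [add_mul, Real.exp_add, Real.exp_neg]
            field_simp
            ring

lemma exists_eqOn_of_traceSpace_eq {Λ : Set ℂ} {m : ℕ}
    (h : traceSpace p Λ = dividedDifferenceSpace p Λ m) {F : ℂ → ℂ}
    (hF : HasBoundedDifferences p Λ m F) : ∃ f ∈ hormanderAlgebra p, ∀ z ∈ Λ, f z = F z := by
  have := (mem_dividedDifferenceSpace_iff (ω := fun l : Λ => F l) fun _ => rfl).2 hF
  rw [← h] at this
  obtain ⟨f, hf, hfF⟩ := this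
  exact ⟨f, hf, fun z hz => congrFun hfF ⟨z, hz⟩⟩

/-- The nodes in the unit disc about `l` whose product of distances to `l` is minimal. -/
lemma exists_minimal_nodes {Λ : Set ℂ} (hfin : ∀ c R, (Λ ∩ Metric.closedBall c R).Finite) (m : ℕ)
    (l : ℂ) : ∃ T : Finset ℂ, ↑T ⊆ Λ ∧ l ∉ T ∧ T.card ≤ m ∧ (∀ t ∈ T, ‖t - l‖ ≤ 1) ∧
      ∀ s : Finset ℂ, ↑s ⊆ Λ → l ∉ s → s.card ≤ m → ‖∏ t ∈ T, (l - t)‖ ≤ ‖∏ t ∈ s, (l - t)‖ := by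
  classical
  set N : Finset ℂ := (hfin l 1).toFinset.erase l
  have hN : ∀ t, t ∈ N ↔ t ≠ l ∧ t ∈ Λ ∧ ‖t - l‖ ≤ 1 := fun t => by
    simp [N, dist_eq_norm]
  obtain ⟨T, hT, hmin⟩ := Finset.exists_min_image (N.powerset.filter fun T => T.card ≤ m)
    (fun T => ‖∏ t ∈ T, (l - t)‖) ⟨∅, by simp⟩
  rw [Finset.mem_filter, Finset.mem_powerset] at hT
  refine ⟨T, fun t ht => ((hN t).1 (hT.1 ht)).2.1, fun hl => ((hN l).1 (hT.1 hl)).1 rfl, hT.2,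
    fun t ht => ((hN t).1 (hT.1 ht)).2.2, fun s hs hl hsm => ?_⟩
  have hs' : s.filter (fun t => ‖t - l‖ ≤ 1) ∈ N.powerset.filter fun T => T.card ≤ m := by
    rw [Finset.mem_filter, Finset.mem_powerset]
    refine ⟨fun t ht => ?_, (Finset.card_filter_le _ _).trans hsm⟩
    rw [Finset.mem_filter] at ht
    exact (hN t).2 ⟨fun h => hl (h ▸ ht.1), hs ht.1, ht.2⟩
  refine (hmin _ hs').trans ?_
  -- Nodes of `s` outside the unit disc contribute factors at least 1, so discarding them does not
  -- increase the product.
  rw [norm_prod, norm_prod, ← Finset.prod_filter_mul_prod_filter_not s (fun t => ‖t - l‖ ≤ 1)]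
  refine le_mul_of_one_le_right (Finset.prod_nonneg fun _ _ => norm_nonneg _) ?_
  refine Finset.prod_induction _ (fun x : ℝ => 1 ≤ x) (fun _ _ => one_le_mul_of_one_le_of_one_le)
    le_rfl fun t ht => ?_
  rw [norm_sub_rev]
  exact (not_le.1 (Finset.mem_filter.1 ht).2).le

/-- The uniform pieces have value w(l) at l, the minimal product over `T l`, and vanish on the rest
of Λ. One more zero x close to l, outside `T l`, would force |w(l)| ≤ const · |l - x| · |w(l)| with
const · |l - x| < 1, although w(l) ≠ 0. -/
lemma exists_card_le_of_traceSpace_eq (hp : IsWeight p) {Λ : Set ℂ}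
    (hfin : ∀ c R, (Λ ∩ Metric.closedBall c R).Finite) {n : ℕ} (hn : 1 ≤ n)
    (h : traceSpace p Λ = dividedDifferenceSpace p Λ (n - 1)) :
    ∃ ε C : ℝ, 0 < ε ∧ ε ≤ 1 ∧ 0 < C ∧ ∀ l ∈ Λ, ∀ s : Finset ℂ, ↑s ⊆ Λ →
      (∀ y ∈ s, ‖y - l‖ < ε * Real.exp (-(C * p l))) → s.card ≤ n := by
  classical
  choose T hTΛ hlT hTc hT1 hTmin using exists_minimal_nodes hfin (n - 1)
  obtain ⟨A, B, hA, hB, hpk⟩ := exists_uniform_of_forall_subset hp (Γ := Λ)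
    (fun l => ∏ t ∈ T l, (l - t)) fun S => by
      obtain ⟨f, hf, hfF⟩ := exists_eqOn_of_traceSpace_eq h
        (F := fun l => if l ∈ S then ∏ t ∈ T l, (l - t) else 0) (by
          refine ⟨n, 1, by positivity, one_pos, fun s hs hc => ?_⟩
          have hS : 0 ≤ ∑ a ∈ s, p a := Finset.sum_nonneg fun b _ => hp.nonneg b
          -- By minimality of `T a` against the n - 1 other nodes, each of the n Lagrange terms has
          -- modulus at most 1, whatever the subset `S`.
          have h1 : ∀ a ∈ s, ‖(if a ∈ S then ∏ t ∈ T a, (a - t) else 0) /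
              ∏ b ∈ s.erase a, (a - b)‖ ≤ 1 := by
            intro a ha
            rw [norm_div]
            refine div_le_one_of_le₀ ?_ (norm_nonneg _)
            split_ifs
            · refine hTmin a _ (fun z hz => hs (Finset.mem_of_mem_erase hz))
                (Finset.notMem_erase a s) ?_
              rw [Finset.card_erase_of_mem ha]
              omega
            · rw [norm_zero]
              exact norm_nonneg _
          refine (norm_sum_le_of_le s h1).trans ?_
          rw [Finset.sum_const, hc, nsmul_eq_mul, mul_one, Nat.sub_add_cancel hn]
          exact le_mul_of_one_le_right n.cast_nonneg (Real.one_le_exp (by positivity)))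
      exact ⟨f, hf, fun z hz hS => by simpa only [hS, if_true] using hfF z hz,
        fun z hz hS => by simpa only [hS, if_false] using hfF z hz⟩
  obtain ⟨D, E, hD, hE, hsl⟩ := hp.slowly_varying 2
  refine ⟨min 1 (1 / (A * Real.exp (B * E))), B * D, by positivity, min_le_left _ _,
    by positivity, fun l hl s hs hsl' => ?_⟩
  by_contra hcard
  obtain ⟨f, hf, hfl, hf0⟩ := hpk l hl
  have hcardT : (insert l (T l)).card < s.card := by
    rw [Finset.card_insert_of_notMem (hlT l)]
    have := hTc l
    omega
  obtain ⟨x, hxs, hxT⟩ := Finset.exists_mem_notMem_of_card_lt_card hcardT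
  rw [Finset.mem_insert, not_or] at hxT
  have hpl := hp.nonneg l
  set r := min 1 (1 / (A * Real.exp (B * E))) * Real.exp (-(B * D * p l)) with hr
  have hr1 : r ≤ 1 := mul_le_one₀ (min_le_left _ _) (Real.exp_pos _).le
    (Real.exp_le_one_iff.2 (by
      have : 0 ≤ B * D * p l := by positivity
      linarith))
  have hxl := hsl' x hxs
  have h1 := norm_le_mul_prod_of_zeros (M := A * Real.exp (B * (D * p l + E))) l (insert x (T l)) f
    hf.1 (fun z hz => (hf.2 z).trans (by
      have := hsl z l (by simpa using hz)
      gcongr)) (fun t ht => ?_) (fun t ht => ?_)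
  · rw [hfl, Finset.prod_insert hxT.2, ← norm_prod] at h1
    have hw : 0 < ‖∏ t ∈ T l, (l - t)‖ := norm_pos_iff.2 (prod_sub_ne_zero (hlT l))
    rw [← mul_assoc, le_mul_iff_one_le_left hw] at h1
    have h2 : A * Real.exp (B * (D * p l + E)) * r ≤ 1 := by
      calc A * Real.exp (B * (D * p l + E)) * r ≤ A * Real.exp (B * (D * p l + E)) *
            (1 / (A * Real.exp (B * E)) * Real.exp (-(B * D * p l))) := by
            rw [hr]
            gcongr
            exact min_le_right _ _
        _ = 1 := by
            rw [mul_add, Real.exp_add, Real.exp_neg, mul_assoc B]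
            field_simp
    rw [norm_sub_rev] at h1
    have h3 : 0 < A * Real.exp (B * (D * p l + E)) := by positivity
    linarith [mul_lt_mul_of_pos_left hxl h3]
  · rcases Finset.mem_insert.1 ht with rfl | ht
    · exact hf0 t (hs hxs) hxT.1
    · exact hf0 t (hTΛ l ht) fun h => hlT l (h ▸ ht)
  · rcases Finset.mem_insert.1 ht with rfl | ht
    · exact hxl.le.trans hr1
    · exact hT1 l t ht

/-- Chains of steps shorter than `η` do not leave the disc of radius `δ` about their origin. -/
lemma norm_lt_of_reflTransGen {Λ : Set ℂ} {n : ℕ} {η : ℂ → ℝ} {δ : ℝ} {x : ℂ} (hδ : 0 < δ)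
    (hx : x ∈ Λ) (hfin : (Λ ∩ Metric.closedBall x δ).Finite)
    (hcard : ∀ s : Finset ℂ, ↑s ⊆ Λ → (∀ y ∈ s, ‖y - x‖ < δ) → s.card ≤ n)
    (hη : ∀ y ∈ Λ, ‖y - x‖ ≤ δ → η y * (n + 1) ≤ δ) {y : ℂ}
    (hxy : Relation.ReflTransGen (fun u v => v ∈ Λ ∧ ‖v - u‖ < min (η u) (η v)) x y) :
    y ∈ Λ ∧ ‖y - x‖ < δ := by
  classical
  set N : Finset ℂ := hfin.toFinset.filter fun z => ‖z - x‖ < δ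
  have hN : ∀ z, z ∈ N ↔ z ∈ Λ ∧ ‖z - x‖ < δ := fun z => by
    simp only [N, Finset.mem_filter, Set.Finite.mem_toFinset, Set.mem_inter_iff,
      mem_closedBall_iff_norm]
    exact ⟨fun h => ⟨h.1.1, h.2⟩, fun h => ⟨⟨h.1, h.2.le⟩, h.2⟩⟩
  have hxN : x ∈ N := (hN x).2 ⟨hx, by simpa using hδ⟩
  have hNc : N.card ≤ n := hcard N (fun z hz => ((hN z).1 hz).1) fun z hz => ((hN z).1 hz).2
  -- `k z` is the index of the annulus of width δ/(n+1) about `x` that contains `z`. At most n - 1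
  -- points other than `x` compete for the annuli 1, …, n, so some annulus `j` is empty, and steps
  -- shorter than its width cannot cross it.
  set k : ℂ → ℕ := fun z => ⌊‖z - x‖ * (n + 1) / δ⌋₊
  have hlt : ((N.erase x).image k).card < (Finset.Icc 1 n).card := by
    refine Finset.card_image_le.trans_lt ?_
    rw [Finset.card_erase_of_mem hxN, Nat.card_Icc]
    have := Finset.card_pos.2 ⟨x, hxN⟩
    omega
  obtain ⟨j, hj, hjk⟩ := Finset.exists_mem_notMem_of_card_lt_card hlt
  rw [Finset.mem_Icc] at hj
  have hn1 : (0 : ℝ) < n + 1 := by positivity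
  have hjn : (j : ℝ) + 1 ≤ n + 1 := by exact_mod_cast Nat.succ_le_succ hj.2
  have key : y ∈ Λ ∧ ‖y - x‖ * (n + 1) < j * δ := by
    induction hxy with
    | refl =>
      refine ⟨hx, ?_⟩
      have : (0 : ℝ) < j := by exact_mod_cast hj.1
      simpa using mul_pos this hδ
    | @tail u v _ huv ih =>
      obtain ⟨hu, hux⟩ := ih
      obtain ⟨hv, hvu⟩ := huv
      have huδ : ‖u - x‖ ≤ δ := by
        have : ‖u - x‖ * (n + 1) ≤ δ * (n + 1) := by nlinarith
        exact le_of_mul_le_mul_right this hn1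
      have h1 := hη u hu huδ
      have h2 : ‖v - x‖ ≤ ‖v - u‖ + ‖u - x‖ := norm_sub_le_norm_sub_add_norm_sub v u x
      have h3 := hvu.trans_le (min_le_left _ _)
      have h4 : ‖v - x‖ * (n + 1) < (j + 1) * δ := by nlinarith
      refine ⟨hv, ?_⟩
      by_contra hge
      rw [not_lt] at hge
      have hvx : v ≠ x := by
        rintro rfl
        have : (0 : ℝ) < j := by exact_mod_cast hj.1
        simp only [sub_self, norm_zero, zero_mul] at hge
        linarith [mul_pos this hδ]
      refine hjk (Finset.mem_image.2 ⟨v, Finset.mem_erase.2 ⟨hvx, (hN v).2 ⟨hv, ?_⟩⟩, ?_⟩)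
      · have : ‖v - x‖ * (n + 1) < δ * (n + 1) := by nlinarith
        exact lt_of_mul_lt_mul_right this hn1.le
      · rw [Nat.floor_eq_iff (by positivity), le_div_iff₀ hδ, div_lt_iff₀ hδ]
        exact ⟨hge, h4⟩
  refine ⟨key.1, ?_⟩
  have : ‖y - x‖ * (n + 1) < δ * (n + 1) := by nlinarith
  exact lt_of_mul_lt_mul_right this hn1.le

lemma exists_injOn_fin {α : Type*} {n : ℕ} (hn : 1 ≤ n) (K : Set α) (hK : K.Finite)
    (hc : hK.toFinset.card ≤ n) : ∃ e : α → Fin n, Set.InjOn e K := by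
  classical
  have : Nonempty (Fin n) := ⟨⟨0, hn⟩⟩
  obtain ⟨φ⟩ := Function.Embedding.nonempty_of_card_le (α := hK.toFinset) (β := Fin n)
    (by simpa using hc)
  refine ⟨fun z => if hz : z ∈ K then φ ⟨z, hK.mem_toFinset.2 hz⟩ else Classical.arbitrary _,
    fun a ha b hb hab => ?_⟩
  simp only [ha, hb, dif_pos] at hab
  exact congrArg Subtype.val (φ.injective hab)

/-- Partition of `Λ` into small clusters, with the points of each cluster numbered. -/
lemma exists_clusters {Λ : Set ℂ} (hfin : ∀ c R, (Λ ∩ Metric.closedBall c R).Finite) {n : ℕ}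
    (hn : 1 ≤ n) {η δ : ℂ → ℝ} (hδ : ∀ x, 0 < δ x)
    (hcard : ∀ x ∈ Λ, ∀ s : Finset ℂ, ↑s ⊆ Λ → (∀ y ∈ s, ‖y - x‖ < δ x) → s.card ≤ n)
    (hη : ∀ x ∈ Λ, ∀ y ∈ Λ, ‖y - x‖ ≤ δ x → η y * (n + 1) ≤ δ x) :
    ∃ (K : ℂ → Set ℂ) (c : ℂ → Fin n), (∀ x, x ∈ K x) ∧
      (∀ x ∈ Λ, ∀ y ∈ K x, y ∈ Λ ∧ ‖y - x‖ < δ x ∧ K y = K x) ∧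
      (∀ x ∈ Λ, ∀ y ∈ Λ, K x ≠ K y → min (η x) (η y) ≤ ‖x - y‖) ∧
      ∀ x ∈ Λ, ∀ y ∈ K x, c x = c y → x = y := by
  classical
  have : Nonempty (Fin n) := ⟨⟨0, hn⟩⟩
  -- The minimum makes the relation symmetric on Λ, so reachability splits Λ into classes.
  set R : ℂ → ℂ → Prop := fun u v => v ∈ Λ ∧ ‖v - u‖ < min (η u) (η v) with hR
  set K : ℂ → Set ℂ := fun x => {y | Relation.ReflTransGen R x y} with hK
  have hKmem : ∀ x ∈ Λ, ∀ y ∈ K x, y ∈ Λ ∧ ‖y - x‖ < δ x := fun x hx y hy =>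
    norm_lt_of_reflTransGen (hδ x) hx (hfin _ _) (hcard x hx) (hη x hx) hy
  have hsymm : ∀ x ∈ Λ, ∀ y ∈ K x, x ∈ K y := by
    intro x hx y hy
    induction hy with
    | refl => exact Relation.ReflTransGen.refl
    | @tail u v hxu huv ih =>
      refine Relation.ReflTransGen.head ⟨(hKmem x hx u hxu).1, ?_⟩ ih
      rw [norm_sub_rev, min_comm]
      exact huv.2
  have hKeq : ∀ x ∈ Λ, ∀ y ∈ K x, K y = K x := fun x hx y hy =>
    Set.Subset.antisymm (fun _ hz => Relation.ReflTransGen.trans hy hz)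
      fun _ hz => Relation.ReflTransGen.trans (hsymm x hx y hy) hz
  -- The numbering is attached to the cluster as a set, so all its points share the same one.
  have he : ∀ S : Set ℂ, ∃ e : ℂ → Fin n, ∀ x ∈ Λ, S = K x → Set.InjOn e S := by
    intro S
    by_cases hS : ∃ x ∈ Λ, S = K x
    · obtain ⟨x, hx, rfl⟩ := hS
      have hKf : (K x).Finite := (hfin x (δ x)).subset fun y hy =>
        ⟨(hKmem x hx y hy).1, mem_closedBall_iff_norm.2 (hKmem x hx y hy).2.le⟩
      obtain ⟨e, he⟩ := exists_injOn_fin hn (K x) hKf (hcard x hx _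
        (fun y hy => (hKmem x hx y (by simpa using hy)).1)
        fun y hy => (hKmem x hx y (by simpa using hy)).2)
      exact ⟨e, fun _ _ _ => he⟩
    · exact ⟨fun _ => Classical.arbitrary _, fun x hx h => absurd ⟨x, hx, h⟩ hS⟩
  choose e he using he
  refine ⟨K, fun x => e (K x) x, fun x => Relation.ReflTransGen.refl, fun x hx y hy =>
    ⟨(hKmem x hx y hy).1, (hKmem x hx y hy).2, hKeq x hx y hy⟩, fun x hx y hy hne => ?_,
    fun x hx y hy hc => ?_⟩
  · by_contra hlt
    rw [not_le, norm_sub_rev] at hlt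
    exact hne (hKeq x hx y (Relation.ReflTransGen.single ⟨hy, hlt⟩)).symm
  · simp only [hKeq x hx y hy] at hc
    exact he (K x) x hx rfl Relation.ReflTransGen.refl hy hc

lemma exists_iUnion_of_traceSpace_eq (hp : IsWeight p) {Λ : Set ℂ}
    (hfin : ∀ c R, (Λ ∩ Metric.closedBall c R).Finite) {n : ℕ} (hn : 1 ≤ n)
    (h : traceSpace p Λ = dividedDifferenceSpace p Λ (n - 1)) :
    ∃ Γ : Fin n → Set ℂ, (∀ i, IsInterpolating p (Γ i)) ∧ Λ = ⋃ i, Γ i := by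
  classical
  obtain ⟨ε, C, hε, hε1, hC, hcard⟩ := exists_card_le_of_traceSpace_eq hp hfin hn h
  obtain ⟨D, E, hD, hE, hsl⟩ := hp.slowly_varying 1
  have hδ1 : ∀ x, ε * Real.exp (-(C * p x)) ≤ 1 := fun x =>
    mul_le_one₀ hε1 (Real.exp_pos _).le (Real.exp_le_one_iff.2 (by
      have := mul_nonneg hC.le (hp.nonneg x)
      linarith))
  -- exp(-C E), with the exponent `C * D` in `η`, transfers the radius from `x` to a nearby `y` by
  -- slow variation; the division by n + 1 meets the step size required of chains.
  set ε' : ℝ := ε * Real.exp (-(C * E)) / (n + 1) with hε'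
  have hε'0 : 0 < ε' := by positivity
  obtain ⟨K, c, hKx, hK, hKsep, hKc⟩ := exists_clusters hfin hn
    (η := fun y => ε' * Real.exp (-(C * D * p y))) (δ := fun x => ε * Real.exp (-(C * p x)))
    (fun x => by positivity) hcard fun x _ y _ hxy => by
      have h1 := hsl x y (by rw [norm_sub_rev]; simpa using hxy.trans (hδ1 x))
      have h2 : ε' * Real.exp (-(C * D * p y)) * (n + 1) =
          ε * Real.exp (-(C * E) + -(C * D * p y)) := by
        rw [hε', Real.exp_add]
        field_simp
      rw [h2]
      gcongr
      nlinarith [mul_le_mul_of_nonneg_left h1 hC.le]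
  refine ⟨fun i => {x | x ∈ Λ ∧ c x = i}, fun i => ?_, ?_⟩
  swap
  · ext x
    simp
  refine isInterpolating_of_exists fun F A B hA hB hF => ?_
  set Γ : Set ℂ := {x | x ∈ Λ ∧ c x = i}
  -- As a function of the cluster, `H` is constant on it: the value of `F` at its point of `Γ`,
  -- unique because the numbering is injective, or 0 if the cluster misses `Γ`.
  set H : Set ℂ → ℂ := fun S => if hS : (S ∩ Γ).Nonempty then F hS.some else 0 with hH
  have hHΓ : ∀ x ∈ Γ, H (K x) = F x := by
    intro x hx
    have hne : (K x ∩ Γ).Nonempty := ⟨x, hKx x, hx⟩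
    simp only [hH, hne, dif_pos]
    rw [← hKc x hx.1 _ hne.some_mem.1 (hx.2.trans hne.some_mem.2.2.symm)]
  have hHd : HasBoundedDifferences p Λ (n - 1) fun x => H (K x) := by
    refine hasBoundedDifferences_of_separated hp (A := A * Real.exp (B * E)) (B := B * D)
      (ε := ε') (C := C * D) (by positivity) (by positivity) hε'0 (by positivity)
      (fun x hx => ?_) (fun x hx y hy hne => ?_) _
    · simp only [hH]
      split_ifs with hne
      · obtain ⟨h1, h2⟩ := hne.some_mem
        refine (hF _ h2).trans ?_
        have h3 := hsl hne.some x (by simpa using (hK x hx _ h1).2.1.le.trans (hδ1 x))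
        rw [mul_assoc, ← Real.exp_add]
        gcongr
        nlinarith [mul_le_mul_of_nonneg_left h3 hB.le]
      · rw [norm_zero]
        positivity
    · refine le_trans ?_ (hKsep x hx y hy fun hK => hne (congrArg H hK))
      have hx0 := hp.nonneg x
      have hy0 := hp.nonneg y
      refine le_min ?_ ?_ <;>
      · gcongr
        linarith
  obtain ⟨f, hf, hfH⟩ := exists_eqOn_of_traceSpace_eq h hHd
  exact ⟨f, hf, fun γ hγ => (hfH γ hγ.1).trans (hHΓ γ hγ)⟩

end HormanderTrace

theorem theorem1p1 (p : ℂ → ℝ) (hp : HormanderTrace.IsWeight p)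
    (Λ : Set ℂ) (hclosed : IsClosed Λ) (hdiscrete : IsDiscrete Λ)
    (n : ℕ) (hn : 1 ≤ n) :
    HormanderTrace.traceSpace p Λ = HormanderTrace.dividedDifferenceSpace p Λ (n - 1) ↔
      ∃ Γ : Fin n → Set ℂ,
        (∀ i, HormanderTrace.IsInterpolating p (Γ i)) ∧ Λ = ⋃ i, Γ i :=
  ⟨HormanderTrace.exists_iUnion_of_traceSpace_eq hp
    (HormanderTrace.finite_inter_closedBall hclosed hdiscrete) hn,
    fun ⟨_, hΓ, hΛ⟩ => HormanderTrace.traceSpace_eq_of_iUnion hp hclosed hdiscrete hn hΓ hΛ⟩
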